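/- Let $\mathcal K$ be a (strict) 2-category. An *enhanced factorization system* on $\mathcal K$ is a pair $(\mathcal E,\mathcal M)$ of classes of 1-cells, both containing all isomorphisms, such that (i) every 1-cell $f$ factors as $f=m\circ e$ with $e\in\mathcal E$, $m\in\mathcal M$; (ii) for $e\colon A\to X$ in $\mathcal E$, $m\colon B\to Y$ in $\mathcal M$, 1-cells $v\colon A\to B$, $u\colon X\to Y$ and an invertible 2-cell $\varphi\colon u\circ e\Rightarrow m\circ v$, there is a unique pair $(w,\widetilde\varphi)$ of a 1-cell $w\colon X\to B$ and an invertible 2-cell $\widetilde\varphi\colon u\Rightarrow m\circ w$ with $w\circ e=v$ and $\widetilde\varphi\circ e=\varphi$; (iii) if $e\in\mathcal E$, $m\in\mathcal M$, $u\circ e=m\circ v$ and $u'\circ e=m\circ v'$ have fillers $w,w'$ (so $w\circ e=v$, $m\circ w=u$, $w'\circ e=v'$, $m\circ w'=u'$), and $\sigma\colon v\Rightarrow v'$, $\tau\colon u\Rightarrow u'$ are 2-cells with $\tau\circ e=m\circ\sigma$, then there is a unique 2-cell $\rho\colon w\Rightarrow w'$ with $\rho\circ e=\sigma$ and $m\circ\rho=\tau$.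 It is *rigid* if moreover, for every $m\colon Y\to X$ in $\mathcal M$ and every 1-cell $f\colon X\to Y$, $m\circ f\cong\mathrm{id}_X$ implies $f\circ m\cong\mathrm{id}_Y$. Let $(T,\iota,\mu)$ be a 2-monad on $\mathcal K$ (a 2-functor with 2-natural unit and multiplication satisfying the monad laws strictly). A *strict $T$-algebra* is an object $X$ with a 1-cell $\theta\colon TX\to X$ such that $\theta\circ\iota_X=\mathrm{id}_X$ and $\theta\circ T\theta=\theta\circ\mu_X$. A *normal $T$-pseudoalgebra* $(X,\theta,\varphi)$ has instead $\theta\circ\iota_X=\mathrm{id}_X$ and an invertible 2-cell $\varphi\colon\theta\circ T\theta\Rightarrow\theta\circ\mu_X$ such that $\varphi\circ\iota_{TX}$ and $\varphi\circ T\iota_X$ are identities and the composites $$\theta\circ T\theta\circ T^2\theta\xRightarrow{\varphi\circ T^2\theta}\theta\circ\mu_X\circ T^2\theta=\theta\circ T\theta\circ\mu_{TX}\xRightarrow{\varphi\circ\mu_{TX}}\theta\circ\mu_X\circ\mu_{TX},$$ $$\theta\circ T\theta\circ T^2\theta\xRightarrow{\theta\circ T\varphi}\theta\circ T\theta\circ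 T\mu_X\xRightarrow{\varphi\circ T\mu_X}\theta\circ\mu_X\circ T\mu_X=\theta\circ\mu_X\circ\mu_{TX}$$ are equal. A *$T$-pseudomorphism* $(f,\zeta)\colon(X,\theta,\varphi)\to(Y,\xi,\psi)$ is a 1-cell $f\colon X\to Y$ with an invertible 2-cell $\zeta\colon\xi\circ Tf\Rightarrow f\circ\theta$ such that $\zeta\circ\iota_X$ is the identity and $(f\circ\varphi)\cdot(\zeta\circ T\theta)\cdot(\xi\circ T\zeta)=(\zeta\circ\mu_X)\cdot(\psi\circ T^2f)$; it is a *strict $T$-map* if $\zeta$ is the identity. An *algebra 2-cell* $(f,\zeta)\Rightarrow(g,\kappa)$ is a 2-cell $\lambda\colon f\Rightarrow g$ with $\kappa\cdot(\xi\circ T\lambda)=(\lambda\circ\theta)\cdot\zeta$. Let $T\text{-}\mathbf{PsAlg}$ be the 2-category of normal $T$-pseudoalgebras, $T$-pseudomorphisms and algebra 2-cells, and $T\text{-}\mathbf{AlgSt}$ that of strict $T$-algebras, strict $T$-maps and algebra 2-cells. **Theorem.** Let $(\mathcal E,\mathcal M)$ be a rigid enhanced factorization system on $\mathcal K$ and let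 $T$ be a 2-monad on $\mathcal K$ that preserves $\mathcal E$, i.e. $Te\in\mathcal E$ for every $e\in\mathcal E$. Then the inclusion 2-functor $J\colon T\text{-}\mathbf{AlgSt}\to T\text{-}\mathbf{PsAlg}$ has a left 2-adjoint 2-functor $\mathbf{St}\colon T\text{-}\mathbf{PsAlg}\to T\text{-}\mathbf{AlgSt}$ (with 2-natural unit and counit satisfying the triangle identities strictly), and for every normal $T$-pseudoalgebra $X$ the component $X\to J\,\mathbf{St}X$ of the unit is an internal adjoint equivalence in $T\text{-}\mathbf{PsAlg}$. -/

import Mathlib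

open CategoryTheory Bicategory

-- Only the bicategory structure of a 2-category is used; this avoids a second path to its quiver.
attribute [-instance] StrictBicategory.category

universe w v u w₁ v₁ u₁ w₂ v₂ u₂

namespace PowerLack

/-! Throughout, a 2-category is a bicategory `K` with `[Bicategory.Strict K]`, a 2-functor is a
`StrictPseudofunctor`, and `f ≫ g` is the composite usually written `g ∘ f`.  An identity 2-cell
between two 1-cells that are equal, but not definitionally so, is written `eqToHom _`. -/

section Strict

variable {K : Type u} [Bicategory.{w, v} K] [Bicategory.Strict K]

theorem whiskerLeft_whiskerLeft_congr {a b b' c d : K} {f : a ⟶ b} {g : b ⟶ c} {f' : a ⟶ b'}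
    {g' : b' ⟶ c} (e : f ≫ g = f' ≫ g') {h h' : c ⟶ d} (α : h ⟶ h') :
    f ◁ g ◁ α = eqToHom (by rw [← Strict.assoc, e, Strict.assoc]) ≫ f' ◁ g' ◁ α ≫
      eqToHom (by rw [← Strict.assoc, ← e, Strict.assoc]) := by
  have h := congr_whiskerLeft e α
  simp only [comp_whiskerLeft, Strict.associator_eqToIso, eqToIso.hom, eqToIso.inv,
    Category.assoc, eqToHom_trans, eqToHom_trans_assoc] at h
  simpa [eqToHom_comp_iff, comp_eqToHom_iff] using h

theorem whisker_exchange_congr {a b b₁ b₂ c d : K} {f f' : a ⟶ b} (α : f ⟶ f') {g : b ⟶ c}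
    {h₀ : c ⟶ d} {c' : K} {k : b ⟶ c'} {l : c' ⟶ d} (β : g ≫ h₀ ⟶ k ≫ l)
    {r : a ⟶ b₁} {s : b₁ ⟶ b} {p : a ⟶ b₂} {q : b₂ ⟶ b} (e : r ≫ s = f) (e' : p ≫ q = f') :
    α ▷ g ▷ h₀ ≫ eqToHom (by rw [← e']; simp only [Strict.assoc]) ≫ p ◁ q ◁ β =
      eqToHom (by rw [← e]; simp only [Strict.assoc]) ≫ r ◁ s ◁ β ≫
        eqToHom (by rw [← e]; simp only [Strict.assoc]) ≫ α ▷ k ▷ l ≫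
          eqToHom (by rw [← e']; simp only [Strict.assoc]) := by
  subst e e'
  have h := whisker_exchange α β
  simp only [comp_whiskerLeft, whiskerRight_comp, Strict.associator_eqToIso, eqToIso.hom,
    eqToIso.inv, Category.assoc, eqToHom_trans_assoc] at h
  have h' := congrArg (fun t => eqToHom (by simp only [Strict.assoc] :
    ((r ≫ s) ≫ g) ≫ h₀ = _) ≫ t ≫ eqToHom (by simp only [Strict.assoc] : _ = p ≫ q ≫ k ≫ l)) h
  simpa using h'.symm

end Strict

section TwoNat

variable {B : Type u₁} [Bicategory.{w₁, v₁} B] {C : Type u₂} [Bicategory.{w₂, v₂} C]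

/-- A 2-natural transformation between 2-functors. -/
structure TwoNatTrans (F G : StrictPseudofunctor B C) where
  app (a : B) : F.obj a ⟶ G.obj a
  naturality {a b : B} (f : a ⟶ b) : F.map f ≫ app b = app a ≫ G.map f
  naturality₂ {a b : B} {f g : a ⟶ b} (α : f ⟶ g) :
    F.map₂ α ▷ app b ≫ eqToHom (naturality g) = eqToHom (naturality f) ≫ app a ◁ G.map₂ α

/-- A 2-adjunction `F ⊣ G`, given by a 2-natural unit and counit that satisfy the triangle
identities. -/
structure TwoAdjunction (F : StrictPseudofunctor B C) (G : StrictPseudofunctor C B) where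
  unit : TwoNatTrans (StrictPseudofunctor.id B) (F.comp G)
  counit : TwoNatTrans (G.comp F) (StrictPseudofunctor.id C)
  left_triangle (b : B) : F.map (unit.app b) ≫ counit.app (F.obj b) = 𝟙 (F.obj b)
  right_triangle (c : C) : unit.app (G.obj c) ≫ G.map (counit.app c) = 𝟙 (G.obj c)

end TwoNat

section Factorization

variable {K : Type u} [Bicategory.{w, v} K] [Bicategory.Strict K]

/-- An enhanced factorization system on a 2-category: `E` and `M` are classes of 1-cells. -/
structure IsEnhancedFactorizationSystem (E M : MorphismProperty K) : Prop where
  left_of_iso {X Y : K} (f : X ⟶ Y) (g : Y ⟶ X) : f ≫ g = 𝟙 X → g ≫ f = 𝟙 Y → E f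
  right_of_iso {X Y : K} (f : X ⟶ Y) (g : Y ⟶ X) : f ≫ g = 𝟙 X → g ≫ f = 𝟙 Y → M f
  factor {X Y : K} (f : X ⟶ Y) : ∃ (I : K) (e : X ⟶ I) (m : I ⟶ Y), E e ∧ M m ∧ e ≫ m = f
  /-- An invertible 2-cell `φ : u ∘ e ⟹ m ∘ v` has a unique filler `(w, ψ)` with
  `w ∘ e = v` and `ψ ∘ e = φ`. -/
  fill {A X B Y : K} (e : A ⟶ X) (m : B ⟶ Y) (v : A ⟶ B) (u : X ⟶ Y) (_ : E e) (_ : M m)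
    (φ : e ≫ u ≅ v ≫ m) :
    ∃! p : (w : X ⟶ B) × (u ≅ w ≫ m), ∃ h : e ≫ p.1 = v,
      e ◁ p.2.hom ≫ eqToHom (by rw [← Strict.assoc, h]) = φ.hom
  /-- The two-dimensional filling property. The 1-cells `w` and `w'` are the fillers of the
  commuting squares `u ∘ e = m ∘ v` and `u' ∘ e = m ∘ v'`. -/
  fill₂ {A X B Y : K} (e : A ⟶ X) (m : B ⟶ Y) (v v' : A ⟶ B) (u u' : X ⟶ Y) (_ : E e) (_ : M m)
    (hs : e ≫ u = v ≫ m) (hs' : e ≫ u' = v' ≫ m) (σ : v ⟶ v') (τ : u ⟶ u')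
    (_ : e ◁ τ = eqToHom hs ≫ σ ▷ m ≫ eqToHom hs'.symm)
    (w w' : X ⟶ B) (hv : e ≫ w = v) (hu : w ≫ m = u) (hv' : e ≫ w' = v') (hu' : w' ≫ m = u') :
    ∃! ρ : w ⟶ w', e ◁ ρ = eqToHom hv ≫ σ ≫ eqToHom hv'.symm ∧
      ρ ▷ m = eqToHom hu ≫ τ ≫ eqToHom hu'.symm

/-- A rigid enhanced factorization system. -/
structure IsRigidEnhancedFactorizationSystem (E M : MorphismProperty K) : Prop extends
    IsEnhancedFactorizationSystem E M where
  rigid {X Y : K} (m : Y ⟶ X) (_ : M m) (f : X ⟶ Y) :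
    Nonempty (f ≫ m ≅ 𝟙 X) → Nonempty (m ≫ f ≅ 𝟙 Y)

end Factorization

/-- A 2-monad on a 2-category. -/
structure TwoMonad (K : Type u) [Bicategory.{w, v} K] where
  functor : StrictPseudofunctor K K
  unit : TwoNatTrans (StrictPseudofunctor.id K) functor
  mul : TwoNatTrans (functor.comp functor) functor
  unit_mul (X : K) : unit.app (functor.obj X) ≫ mul.app X = 𝟙 (functor.obj X)
  map_unit_mul (X : K) : functor.map (unit.app X) ≫ mul.app X = 𝟙 (functor.obj X)
  mul_mul (X : K) :
    mul.app (functor.obj X) ≫ mul.app X = functor.map (mul.app X) ≫ mul.app X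

namespace TwoMonad

section

variable {K : Type u} [Bicategory.{w, v} K] (T : TwoMonad K)

abbrev obj (X : K) : K := T.functor.obj X

abbrev map {X Y : K} (f : X ⟶ Y) : T.obj X ⟶ T.obj Y := T.functor.map f

abbrev map₂ {X Y : K} {f g : X ⟶ Y} (α : f ⟶ g) : T.map f ⟶ T.map g := T.functor.map₂ α

/-- The component `X ⟶ T X` of the unit. -/
def ι (X : K) : X ⟶ T.obj X := T.unit.app X

/-- The component `T T X ⟶ T X` of the multiplication. -/
def μ (X : K) : T.obj (T.obj X) ⟶ T.obj X := T.mul.app X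

/-- `T` preserves a class of 1-cells. -/
def Preserves (E : MorphismProperty K) : Prop :=
  ∀ ⦃X Y : K⦄ (e : X ⟶ Y), E e → E (T.map e)

theorem map_id (X : K) : T.map (𝟙 X) = 𝟙 (T.obj X) := T.functor.map_id X

theorem map_comp {X Y Z : K} (f : X ⟶ Y) (g : Y ⟶ Z) : T.map (f ≫ g) = T.map f ≫ T.map g :=
  T.functor.map_comp f g

theorem ι_naturality {X Y : K} (f : X ⟶ Y) : f ≫ T.ι Y = T.ι X ≫ T.map f :=
  T.unit.naturality f

theorem μ_naturality {X Y : K} (f : X ⟶ Y) : T.map (T.map f) ≫ T.μ Y = T.μ X ≫ T.map f :=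
  T.mul.naturality f

theorem ι_μ (X : K) : T.ι (T.obj X) ≫ T.μ X = 𝟙 (T.obj X) := T.unit_mul X

theorem map_ι_μ (X : K) : T.map (T.ι X) ≫ T.μ X = 𝟙 (T.obj X) := T.map_unit_mul X

theorem μ_μ (X : K) : T.μ (T.obj X) ≫ T.μ X = T.map (T.μ X) ≫ T.μ X := T.mul_mul X

end

end TwoMonad

variable {K : Type u} [Bicategory.{w, v} K] [Bicategory.Strict K]

/-- A strict `T`-algebra. -/
structure AlgSt (T : TwoMonad K) where
  carrier : K
  act : T.obj carrier ⟶ carrier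
  unit : T.ι carrier ≫ act = 𝟙 carrier
  assoc : T.map act ≫ act = T.μ carrier ≫ act

/-- A normal `T`-pseudoalgebra. -/
structure PsAlg (T : TwoMonad K) where
  carrier : K
  act : T.obj carrier ⟶ carrier
  unit : T.ι carrier ≫ act = 𝟙 carrier
  φ : T.map act ≫ act ≅ T.μ carrier ≫ act
  /-- `φ ∘ ι_{TX}` is the identity of `act`. -/
  ι_φ : T.ι (T.obj carrier) ◁ φ.hom = eqToHom (by
    rw [← Strict.assoc, ← T.ι_naturality, Strict.assoc, unit, ← Strict.assoc, T.ι_μ,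
      Strict.comp_id, Strict.id_comp])
  /-- `φ ∘ T ι_X` is the identity of `act`. -/
  map_ι_φ : T.map (T.ι carrier) ◁ φ.hom = eqToHom (by
    rw [← Strict.assoc, ← T.map_comp, unit, ← Strict.assoc, T.map_ι_μ, T.map_id])
  φ_φ : T.map (T.map act) ◁ φ.hom ≫
      eqToHom (by rw [← Strict.assoc, T.μ_naturality, Strict.assoc]) ≫
        T.μ (T.obj carrier) ◁ φ.hom =
    eqToHom (by rw [← Strict.assoc, ← T.map_comp]) ≫ T.map₂ φ.hom ▷ act ≫
      eqToHom (by rw [T.map_comp, Strict.assoc]) ≫ T.map (T.μ carrier) ◁ φ.hom ≫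
        eqToHom (by rw [← Strict.assoc, ← T.μ_μ, Strict.assoc])

namespace PsAlg

variable {T : TwoMonad K}

/-- A `T`-pseudomorphism `(f, ζ)` of normal `T`-pseudoalgebras. -/
structure Hom (X Y : PsAlg T) where
  f : X.carrier ⟶ Y.carrier
  ζ : T.map f ≫ Y.act ≅ X.act ≫ f
  /-- `ζ ∘ ι_X` is the identity of `f`. -/
  ι_ζ : T.ι X.carrier ◁ ζ.hom = eqToHom (by
    rw [← Strict.assoc, ← T.ι_naturality, Strict.assoc, Y.unit, ← Strict.assoc, X.unit,
      Strict.comp_id, Strict.id_comp])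
  ζ_ζ : eqToHom (by rw [T.map_comp, Strict.assoc]) ≫ T.map₂ ζ.hom ▷ Y.act ≫
      eqToHom (by rw [T.map_comp, Strict.assoc]) ≫ T.map X.act ◁ ζ.hom ≫
        eqToHom (by rw [Strict.assoc]) ≫ X.φ.hom ▷ f ≫ eqToHom (by rw [Strict.assoc]) =
    T.map (T.map f) ◁ Y.φ.hom ≫
      eqToHom (by rw [← Strict.assoc, T.μ_naturality, Strict.assoc]) ≫ T.μ X.carrier ◁ ζ.hom

/-- An algebra 2-cell between `T`-pseudomorphisms. -/
@[ext]
structure Hom₂ {X Y : PsAlg T} (f g : Hom X Y) where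
  cell : f.f ⟶ g.f
  comm : T.map₂ cell ▷ Y.act ≫ g.ζ.hom = f.ζ.hom ≫ X.act ◁ cell

theorem Hom.ext {X Y : PsAlg T} {f g : Hom X Y} (h : f.f = g.f)
    (hζ : f.ζ.hom = eqToHom (by rw [h]) ≫ g.ζ.hom ≫ eqToHom (by rw [h])) : f = g := by
  obtain ⟨f, ζ, _, _⟩ := f
  obtain ⟨g, ξ, _, _⟩ := g
  dsimp only at h
  subst h
  have : ζ = ξ := Iso.ext (by simpa using hζ)
  subst this
  rfl

theorem comp_ι_ζ {X Y Z : PsAlg T} (f : Hom X Y) (g : Hom Y Z) :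
    T.ι X.carrier ◁ (eqToHom (by rw [T.map_comp, Strict.assoc] : T.map (f.f ≫ g.f) ≫ Z.act =
      T.map f.f ≫ T.map g.f ≫ Z.act) ≫ T.map f.f ◁ g.ζ.hom ≫ (α_ _ _ _).inv ≫
      f.ζ.hom ▷ g.f ≫ (α_ _ _ _).hom) = eqToHom (by
    rw [← Strict.assoc, ← T.ι_naturality, Strict.assoc, Z.unit, ← Strict.assoc, X.unit,
      Strict.comp_id, Strict.id_comp]) := by
  have h1 := congrArg (fun t => t ▷ g.f) f.ι_ζ
  have h2 := congrArg (fun t => f.f ◁ t) g.ι_ζ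
  simp [Strict.associator_eqToIso] at h1 h2 ⊢
  rw [eqToHom_comp_iff, comp_eqToHom_iff] at h1
  simp at h1
  rw [whiskerLeft_whiskerLeft_congr (T.ι_naturality f.f).symm, h1, h2]
  simp

theorem comp_ζ_ζ {X Y Z : PsAlg T} (f : Hom X Y) (g : Hom Y Z) (ζ : T.map (f.f ≫ g.f) ≫ Z.act ⟶ X.act ≫ f.f ≫ g.f)
   (hζ : ζ = (eqToHom (by rw [T.map_comp, Strict.assoc] : T.map (f.f ≫ g.f) ≫ Z.act =
      T.map f.f ≫ T.map g.f ≫ Z.act) ≫ T.map f.f ◁ g.ζ.hom ≫ (α_ _ _ _).inv ≫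
      f.ζ.hom ▷ g.f ≫ (α_ _ _ _).hom))
 : eqToHom (by simp only [T.map_comp, Strict.assoc]) ≫ T.map₂ ζ ▷ Z.act ≫
      eqToHom (by rw [T.map_comp, Strict.assoc]) ≫ T.map X.act ◁ ζ ≫
        eqToHom (by rw [Strict.assoc]) ≫ X.φ.hom ▷ (f.f ≫ g.f) ≫ eqToHom (by rw [Strict.assoc]) =
    T.map (T.map (f.f ≫ g.f)) ◁ Z.φ.hom ≫
      eqToHom (by rw [← Strict.assoc, T.μ_naturality, Strict.assoc]) ≫ T.μ X.carrier ◁ ζ := by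
  have h1 := congrArg (fun t => eqToHom (by simp only [T.map_comp, Strict.assoc] :
      (T.map (T.map f.f ≫ Y.act) ≫ Y.act) ≫ g.f = (T.map (T.map f.f) ≫ T.map Y.act ≫ Y.act) ≫ g.f) ≫
    t ▷ g.f ≫ eqToHom (by simp only [Strict.assoc] : _ = ((T.μ X.carrier ≫ X.act) ≫ f.f) ≫ g.f))
    f.ζ_ζ
  have h2 := congrArg (fun t => eqToHom (by simp only [T.map_comp, Strict.assoc] :
      T.map (T.map f.f) ≫ T.map (T.map g.f ≫ Z.act) ≫ Z.act =
        T.map (T.map f.f) ≫ T.map (T.map g.f) ≫ T.map Z.act ≫ Z.act) ≫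
    T.map (T.map f.f) ◁ t ≫ eqToHom (by simp only [Strict.assoc] :
      _ = T.map (T.map f.f) ≫ (T.μ Y.carrier ≫ Y.act) ≫ g.f)) g.ζ_ζ
  have h3 := whisker_exchange_congr (T.map₂ f.ζ.hom) g.ζ.hom (T.map_comp (T.map f.f) Y.act).symm
    (T.map_comp X.act f.f).symm
  subst hζ
  simp [Strict.associator_eqToIso, T.functor.map₂_whisker_left, T.functor.map₂_whisker_right,
    T.functor.mapComp_eq_eqToIso, PrelaxFunctor.map₂_eqToHom] at h1 h2 h3 ⊢
  rw [reassoc_of% h3]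
  simp only [eqToHom_trans_assoc]
  rw [reassoc_of% h1]
  simp only [eqToHom_trans_assoc, eqToHom_trans]
  rw [reassoc_of% h2, congr_whiskerLeft (by simp only [T.map_comp] :
      T.map (T.map (f.f ≫ g.f)) = T.map (T.map f.f) ≫ T.map (T.map g.f)),
    whiskerLeft_whiskerLeft_congr (T.μ_naturality f.f)]
  simp [Strict.associator_eqToIso]

/-- The composite of two pseudomorphisms. -/
abbrev comp {X Y Z : PsAlg T} (f : Hom X Y) (g : Hom Y Z) : Hom X Z where
  f := f.f ≫ g.f
  ζ := eqToIso (by rw [T.map_comp, Strict.assoc]) ≪≫ whiskerLeftIso (T.map f.f) g.ζ ≪≫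
    (α_ _ _ _).symm ≪≫ whiskerRightIso f.ζ g.f ≪≫ α_ _ _ _
  ι_ζ := comp_ι_ζ f g
  ζ_ζ := comp_ζ_ζ f g _ rfl

/-- The identity pseudomorphism. -/
abbrev id (X : PsAlg T) : Hom X X where
  f := 𝟙 X.carrier
  ζ := eqToIso (by rw [T.map_id, Strict.id_comp, Strict.comp_id])
  ι_ζ := by simp
  ζ_ζ := by
    rw [congr_whiskerLeft (by simp only [T.map_id] : T.map (T.map (𝟙 X.carrier)) = 𝟙 _)]
    simp [Strict.leftUnitor_eqToIso, Strict.rightUnitor_eqToIso, PrelaxFunctor.map₂_eqToHom]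

instance {X Y : PsAlg T} : Category (Hom X Y) where
  Hom f g := Hom₂ f g
  id f := ⟨𝟙 f.f, by simp⟩
  comp α β := ⟨α.cell ≫ β.cell, by
    have h1 := α.comm
    have h2 := β.comm
    simp only [TwoMonad.map₂] at h1 h2 ⊢
    simp [h2, reassoc_of% h1]⟩
  id_comp _ := Hom₂.ext (Category.id_comp _)
  comp_id _ := Hom₂.ext (Category.comp_id _)
  assoc _ _ _ := Hom₂.ext (Category.assoc _ _ _)

theorem id_comp {X Y : PsAlg T} (f : Hom X Y) : comp (id X) f = f :=
  Hom.ext (Strict.id_comp _) (by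
    simp only [comp, id, Iso.trans_hom, eqToIso.hom, whiskerLeftIso_hom]
    rw [congr_whiskerLeft (T.map_id X.carrier)]
    simp [Strict.associator_eqToIso, Strict.leftUnitor_eqToIso])

theorem comp_id {X Y : PsAlg T} (f : Hom X Y) : comp f (id Y) = f :=
  Hom.ext (Strict.comp_id _) (by
    simp [comp, id, Strict.associator_eqToIso, Strict.rightUnitor_eqToIso])

theorem assoc {W X Y Z : PsAlg T} (f : Hom W X) (g : Hom X Y) (h : Hom Y Z) :
    comp (comp f g) h = comp f (comp g h) :=
  Hom.ext (Strict.assoc _ _ _) (by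
    simp only [comp, Iso.trans_hom, eqToIso.hom, whiskerLeftIso_hom]
    rw [congr_whiskerLeft (T.map_comp f.f g.f)]
    simp [Strict.associator_eqToIso])

/-- Whiskering of an algebra 2-cell by a pseudomorphism on the side of the source. -/
def whiskerLeft {X Y Z : PsAlg T} (f : Hom X Y) {g h : Hom Y Z} (α : Hom₂ g h) :
    Hom₂ (comp f g) (comp f h) where
  cell := f.f ◁ α.cell
  comm := by
    have h1 := congrArg (fun t => T.map f.f ◁ t) α.comm
    have h2 := congrArg (fun t => t ≫ eqToHom (Strict.assoc _ _ _))
      (whisker_exchange f.ζ.hom α.cell)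
    simp [Strict.associator_eqToIso] at h1 h2
    simp [comp, Strict.associator_eqToIso, T.functor.map₂_whisker_left,
      T.functor.mapComp_eq_eqToIso]
    rw [reassoc_of% h1]
    rw [← h2]
    simp

/-- Whiskering of an algebra 2-cell by a pseudomorphism on the side of the target. -/
def whiskerRight {X Y Z : PsAlg T} {f g : Hom X Y} (α : Hom₂ f g) (h : Hom Y Z) :
    Hom₂ (comp f h) (comp g h) where
  cell := α.cell ▷ h.f
  comm := by
    have h1 := congrArg (fun t => t ▷ h.f) α.comm
    have h2 := congrArg (fun t => eqToHom (Strict.assoc _ _ _) ≫ t)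
      (whisker_exchange (T.map₂ α.cell) h.ζ.hom)
    simp [Strict.associator_eqToIso] at h1 h2
    simp [comp, Strict.associator_eqToIso, T.functor.map₂_whisker_right,
      T.functor.mapComp_eq_eqToIso]
    rw [← reassoc_of% h2]
    simp [reassoc_of% h1]

instance : CategoryStruct (PsAlg T) where
  Hom X Y := Hom X Y
  id X := id X
  comp f g := comp f g

instance (X Y : PsAlg T) : Category (X ⟶ Y) := inferInstanceAs (Category (Hom X Y))

theorem hom₂_ext {X Y : PsAlg T} {f g : X ⟶ Y} {α β : f ⟶ g}
    (h : Hom₂.cell α = Hom₂.cell β) : α = β := Hom₂.ext h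

theorem comp_cell {X Y : PsAlg T} {f g h : X ⟶ Y} (α : f ⟶ g) (β : g ⟶ h) :
    Hom₂.cell (α ≫ β) = Hom₂.cell α ≫ Hom₂.cell β := rfl

theorem eqToHom_cell {X Y : PsAlg T} {f g : X ⟶ Y} (h : f = g) :
    Hom₂.cell (eqToHom h) = eqToHom (congrArg Hom.f h) := by
  subst h; rfl

theorem whiskerLeft_cell {X Y Z : PsAlg T} (f : Hom X Y) {g h : Hom Y Z} (α : Hom₂ g h) :
    (whiskerLeft f α).cell = f.f ◁ α.cell := rfl

theorem whiskerRight_cell {X Y Z : PsAlg T} {f g : Hom X Y} (α : Hom₂ f g) (h : Hom Y Z) :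
    (whiskerRight α h).cell = α.cell ▷ h.f := rfl

instance : Bicategory (PsAlg T) where
  whiskerLeft f _ _ α := whiskerLeft f α
  whiskerRight α h := whiskerRight α h
  associator f g h := eqToIso (assoc f g h)
  leftUnitor f := eqToIso (id_comp f)
  rightUnitor f := eqToIso (comp_id f)
  whiskerLeft_id f g := hom₂_ext (Bicategory.whiskerLeft_id f.f g.f)
  whiskerLeft_comp f _ _ _ α β :=
    hom₂_ext (Bicategory.whiskerLeft_comp f.f (Hom₂.cell α) (Hom₂.cell β))
  id_whiskerLeft α := by
    refine hom₂_ext ?_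
    have := Bicategory.id_whiskerLeft (Hom₂.cell α)
    simp only [Strict.leftUnitor_eqToIso] at this
    simp only [comp_cell, eqToIso.hom, eqToIso.inv, eqToHom_cell]
    exact this
  comp_whiskerLeft f g _ _ α := by
    refine hom₂_ext ?_
    have := Bicategory.comp_whiskerLeft f.f g.f (Hom₂.cell α)
    simp only [Strict.associator_eqToIso] at this
    simp only [comp_cell, eqToIso.hom, eqToIso.inv, eqToHom_cell]
    exact this
  id_whiskerRight f g := hom₂_ext (Bicategory.id_whiskerRight f.f g.f)
  comp_whiskerRight α β h :=
    hom₂_ext (Bicategory.comp_whiskerRight (Hom₂.cell α) (Hom₂.cell β) h.f)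
  whiskerRight_id α := by
    refine hom₂_ext ?_
    have := Bicategory.whiskerRight_id (Hom₂.cell α)
    simp only [Strict.rightUnitor_eqToIso] at this
    simp only [comp_cell, eqToIso.hom, eqToIso.inv, eqToHom_cell]
    exact this
  whiskerRight_comp α f g := by
    refine hom₂_ext ?_
    have := Bicategory.whiskerRight_comp (Hom₂.cell α) f.f g.f
    simp only [Strict.associator_eqToIso] at this
    simp only [comp_cell, eqToIso.hom, eqToIso.inv, eqToHom_cell]
    exact this
  whisker_assoc f _ _ α h := by
    refine hom₂_ext ?_
    have := Bicategory.whisker_assoc f.f (Hom₂.cell α) h.f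
    simp only [Strict.associator_eqToIso] at this
    simp only [comp_cell, eqToIso.hom, eqToIso.inv, eqToHom_cell]
    exact this
  whisker_exchange α β :=
    hom₂_ext (Bicategory.whisker_exchange (Hom₂.cell α) (Hom₂.cell β))
  pentagon f g h i := by
    refine hom₂_ext ?_
    have := Bicategory.pentagon f.f g.f h.f i.f
    simp only [Strict.associator_eqToIso] at this
    simp only [comp_cell, eqToIso.hom, eqToHom_cell, whiskerLeft_cell, whiskerRight_cell]
    exact this
  triangle f g := by
    refine hom₂_ext ?_
    have := Bicategory.triangle f.f g.f
    simp only [Strict.associator_eqToIso, Strict.leftUnitor_eqToIso,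
      Strict.rightUnitor_eqToIso] at this
    simp only [comp_cell, eqToIso.hom, eqToHom_cell, whiskerLeft_cell, whiskerRight_cell]
    exact this

instance : Bicategory.Strict (PsAlg T) where
  id_comp f := id_comp f
  comp_id f := comp_id f
  assoc f g h := assoc f g h
  leftUnitor_eqToIso _ := rfl
  rightUnitor_eqToIso _ := rfl
  associator_eqToIso _ _ _ := rfl

end PsAlg

namespace AlgSt

variable {T : TwoMonad K}

/-- A strict `T`-map of strict `T`-algebras. -/
@[ext]
structure Hom (X Y : AlgSt T) where
  f : X.carrier ⟶ Y.carrier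
  comm : T.map f ≫ Y.act = X.act ≫ f

/-- An algebra 2-cell between strict `T`-maps. -/
@[ext]
structure Hom₂ {X Y : AlgSt T} (f g : Hom X Y) where
  cell : f.f ⟶ g.f
  comm : T.map₂ cell ▷ Y.act ≫ eqToHom g.comm = eqToHom f.comm ≫ X.act ◁ cell

/-- The composite of two strict maps. -/
abbrev comp {X Y Z : AlgSt T} (f : Hom X Y) (g : Hom Y Z) : Hom X Z where
  f := f.f ≫ g.f
  comm := by rw [T.map_comp, Strict.assoc, g.comm, ← Strict.assoc, f.comm, Strict.assoc]

/-- The identity strict map. -/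
abbrev id (X : AlgSt T) : Hom X X where
  f := 𝟙 X.carrier
  comm := by rw [T.map_id, Strict.id_comp, Strict.comp_id]

theorem id_comp {X Y : AlgSt T} (f : Hom X Y) : comp (id X) f = f :=
  Hom.ext (Strict.id_comp _)

theorem comp_id {X Y : AlgSt T} (f : Hom X Y) : comp f (id Y) = f :=
  Hom.ext (Strict.comp_id _)

theorem comp_assoc {W X Y Z : AlgSt T} (f : Hom W X) (g : Hom X Y) (h : Hom Y Z) :
    comp (comp f g) h = comp f (comp g h) :=
  Hom.ext (Strict.assoc _ _ _)

instance {X Y : AlgSt T} : Category (Hom X Y) where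
  Hom f g := Hom₂ f g
  id f := ⟨𝟙 f.f, by simp⟩
  comp α β := ⟨α.cell ≫ β.cell, by
    have h1 := α.comm
    have h2 := β.comm
    simp only [TwoMonad.map₂] at h1 h2 ⊢
    simp [h2, reassoc_of% h1]⟩
  id_comp _ := Hom₂.ext (Category.id_comp _)
  comp_id _ := Hom₂.ext (Category.comp_id _)
  assoc _ _ _ := Hom₂.ext (Category.assoc _ _ _)

/-- Whiskering of an algebra 2-cell by a strict map on the side of the source. -/
def whiskerLeft {X Y Z : AlgSt T} (f : Hom X Y) {g h : Hom Y Z} (α : Hom₂ g h) :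
    Hom₂ (comp f g) (comp f h) where
  cell := f.f ◁ α.cell
  comm := by
    have h1 := congrArg (fun t => T.map f.f ◁ t ≫
      eqToHom (by rw [← Strict.assoc, f.comm, Strict.assoc] : _ = X.act ≫ f.f ≫ h.f)) α.comm
    have h2 := whiskerLeft_whiskerLeft_congr f.comm α.cell
    simp at h1
    simp [comp, Strict.associator_eqToIso, T.functor.map₂_whisker_left,
      T.functor.mapComp_eq_eqToIso]
    rw [h1, h2]
    simp

/-- Whiskering of an algebra 2-cell by a strict map on the side of the target. -/
def whiskerRight {X Y Z : AlgSt T} {f g : Hom X Y} (α : Hom₂ f g) (h : Hom Y Z) :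
    Hom₂ (comp f h) (comp g h) where
  cell := α.cell ▷ h.f
  comm := by
    have h1 := congrArg (fun t => t ▷ h.f ≫ eqToHom (Strict.assoc _ _ _)) α.comm
    have h2 := congrArg (fun t => eqToHom (Strict.assoc _ _ _) ≫ t ≫
      eqToHom (by rw [h.comm, ← Strict.assoc, g.comm, Strict.assoc] : _ = X.act ≫ g.f ≫ h.f))
      (whiskerRight_congr h.comm (T.map₂ α.cell))
    simp [Strict.associator_eqToIso] at h1 h2
    simp [comp, T.functor.map₂_whisker_right, T.functor.mapComp_eq_eqToIso]
    rw [h2]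
    simp [h1]

instance : CategoryStruct (AlgSt T) where
  Hom X Y := Hom X Y
  id X := id X
  comp f g := comp f g

instance (X Y : AlgSt T) : Category (X ⟶ Y) := inferInstanceAs (Category (Hom X Y))

theorem hom₂_ext {X Y : AlgSt T} {f g : X ⟶ Y} {α β : f ⟶ g}
    (h : Hom₂.cell α = Hom₂.cell β) : α = β := Hom₂.ext h

theorem comp_cell {X Y : AlgSt T} {f g h : X ⟶ Y} (α : f ⟶ g) (β : g ⟶ h) :
    Hom₂.cell (α ≫ β) = Hom₂.cell α ≫ Hom₂.cell β := rfl

theorem eqToHom_cell {X Y : AlgSt T} {f g : X ⟶ Y} (h : f = g) :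
    Hom₂.cell (eqToHom h) = eqToHom (congrArg Hom.f h) := by
  subst h; rfl

theorem whiskerLeft_cell {X Y Z : AlgSt T} (f : Hom X Y) {g h : Hom Y Z} (α : Hom₂ g h) :
    (whiskerLeft f α).cell = f.f ◁ α.cell := rfl

theorem whiskerRight_cell {X Y Z : AlgSt T} {f g : Hom X Y} (α : Hom₂ f g) (h : Hom Y Z) :
    (whiskerRight α h).cell = α.cell ▷ h.f := rfl

instance : Bicategory (AlgSt T) where
  whiskerLeft f _ _ α := whiskerLeft f α
  whiskerRight α h := whiskerRight α h
  associator f g h := eqToIso (comp_assoc f g h)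
  leftUnitor f := eqToIso (id_comp f)
  rightUnitor f := eqToIso (comp_id f)
  whiskerLeft_id f g := hom₂_ext (Bicategory.whiskerLeft_id f.f g.f)
  whiskerLeft_comp f _ _ _ α β :=
    hom₂_ext (Bicategory.whiskerLeft_comp f.f (Hom₂.cell α) (Hom₂.cell β))
  id_whiskerLeft α := by
    refine hom₂_ext ?_
    have := Bicategory.id_whiskerLeft (Hom₂.cell α)
    simp only [Strict.leftUnitor_eqToIso] at this
    simp only [comp_cell, eqToIso.hom, eqToIso.inv, eqToHom_cell]
    exact this
  comp_whiskerLeft f g _ _ α := by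
    refine hom₂_ext ?_
    have := Bicategory.comp_whiskerLeft f.f g.f (Hom₂.cell α)
    simp only [Strict.associator_eqToIso] at this
    simp only [comp_cell, eqToIso.hom, eqToIso.inv, eqToHom_cell]
    exact this
  id_whiskerRight f g := hom₂_ext (Bicategory.id_whiskerRight f.f g.f)
  comp_whiskerRight α β h :=
    hom₂_ext (Bicategory.comp_whiskerRight (Hom₂.cell α) (Hom₂.cell β) h.f)
  whiskerRight_id α := by
    refine hom₂_ext ?_
    have := Bicategory.whiskerRight_id (Hom₂.cell α)
    simp only [Strict.rightUnitor_eqToIso] at this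
    simp only [comp_cell, eqToIso.hom, eqToIso.inv, eqToHom_cell]
    exact this
  whiskerRight_comp α f g := by
    refine hom₂_ext ?_
    have := Bicategory.whiskerRight_comp (Hom₂.cell α) f.f g.f
    simp only [Strict.associator_eqToIso] at this
    simp only [comp_cell, eqToIso.hom, eqToIso.inv, eqToHom_cell]
    exact this
  whisker_assoc f _ _ α h := by
    refine hom₂_ext ?_
    have := Bicategory.whisker_assoc f.f (Hom₂.cell α) h.f
    simp only [Strict.associator_eqToIso] at this
    simp only [comp_cell, eqToIso.hom, eqToIso.inv, eqToHom_cell]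
    exact this
  whisker_exchange α β :=
    hom₂_ext (Bicategory.whisker_exchange (Hom₂.cell α) (Hom₂.cell β))
  pentagon f g h i := by
    refine hom₂_ext ?_
    have := Bicategory.pentagon f.f g.f h.f i.f
    simp only [Strict.associator_eqToIso] at this
    simp only [comp_cell, eqToIso.hom, eqToHom_cell, whiskerLeft_cell, whiskerRight_cell]
    exact this
  triangle f g := by
    refine hom₂_ext ?_
    have := Bicategory.triangle f.f g.f
    simp only [Strict.associator_eqToIso, Strict.leftUnitor_eqToIso,
      Strict.rightUnitor_eqToIso] at this
    simp only [comp_cell, eqToIso.hom, eqToHom_cell, whiskerLeft_cell, whiskerRight_cell]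
    exact this

instance : Bicategory.Strict (AlgSt T) where
  id_comp f := id_comp f
  comp_id f := comp_id f
  assoc f g h := comp_assoc f g h
  leftUnitor_eqToIso _ := rfl
  rightUnitor_eqToIso _ := rfl
  associator_eqToIso _ _ _ := rfl

end AlgSt

/-- A strict algebra as a normal pseudoalgebra with identity structure 2-cell. -/
abbrev AlgSt.toPsAlg {T : TwoMonad K} (X : AlgSt T) : PsAlg T where
  carrier := X.carrier
  act := X.act
  unit := X.unit
  φ := eqToIso X.assoc
  ι_φ := by simp
  map_ι_φ := by simp
  φ_φ := by simp [PrelaxFunctor.map₂_eqToHom]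

/-- A strict map as a pseudomorphism with identity structure 2-cell. -/
abbrev AlgSt.Hom.toPsAlg {T : TwoMonad K} {X Y : AlgSt T} (f : AlgSt.Hom X Y) :
    PsAlg.Hom X.toPsAlg Y.toPsAlg where
  f := f.f
  ζ := eqToIso f.comm
  ι_ζ := by simp
  ζ_ζ := by simp [AlgSt.toPsAlg, PrelaxFunctor.map₂_eqToHom]

/-- The inclusion 2-functor of strict algebras and strict maps into normal pseudoalgebras and
pseudomorphisms. -/
def inclusion (T : TwoMonad K) : StrictPseudofunctor (AlgSt T) (PsAlg T) :=
  StrictPseudofunctor.mk''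
    { obj := fun X => X.toPsAlg
      map := fun f => AlgSt.Hom.toPsAlg f
      map₂ := fun α => ⟨AlgSt.Hom₂.cell α, AlgSt.Hom₂.comm α⟩
      map₂_id := fun _ => rfl
      map₂_comp := fun _ _ => rfl
      map_id := fun X => rfl
      map_comp := fun f g => PsAlg.Hom.ext rfl (by
        change _ = eqToHom _ ≫ (PsAlg.comp _ _).ζ.hom ≫ eqToHom _
        simp [Strict.associator_eqToIso])
      map₂_whisker_left := fun f _ _ α => PsAlg.hom₂_ext (by
        simp [PsAlg.comp_cell, PsAlg.eqToHom_cell]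
        rfl)
      map₂_whisker_right := fun α h => PsAlg.hom₂_ext (by
        simp [PsAlg.comp_cell, PsAlg.eqToHom_cell]
        rfl) }

end PowerLack

/-! Let `θ : TX ⟶ X` be the action of a normal pseudoalgebra, and factor it as `θ = e ≫ m` with `e`
in `E` and `m : A ⟶ X` in `M`. Since `Te` is in `E`, the invertible 2-cell `φ` can be filled
diagonally. The filler is an action `TA ⟶ A` together with a 2-cell `ζ` making `m` a pseudomorphism.
Uniqueness of fillers (`filler_unique`) along `e` and `T(Te)` turns the coherence of `φ` into the
strict algebra laws for `A`; the same uniqueness, read on 2-cells, gives the pseudomorphism laws for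
`m`. This is `exists_strict_factorization`.

By normality, `n = ι ≫ e` is a section of `m`, so rigidity gives `m ≫ n ≅ 𝟙`. This isomorphism is
corrected to `β : 𝟙 ≅ m ≫ n` satisfying the triangle identities (`exists_adjoint_retraction`). Then
`n` is a pseudomorphism with structure 2-cell `e ◁ β`, and `β` is an algebra 2-cell, so `n` is an
equivalence in `PsAlg T`.

For a pseudomorphism `(f, ζ)` from `X` to a strict algebra, filling the square with 2-cell `ζ⁻¹`
along `e` against an identity gives the only strict map `g` with `n ≫ g = f` as pseudomorphisms. On
2-cells the universal property is automatic: whiskering with an equivalence is bijective, and the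
inclusion is bijective on 2-cells between strict maps. A family of such universal arrows is a left
2-adjoint.

Composites of 1-cells in a strict 2-category are often only propositionally equal, so pasting
equations fill up with `eqToHom`. Bundling a 2-cell with its ends (`Cell`) makes these identities
vanish, and 1-cells can then be rewritten freely. -/

namespace PowerLack

/-! ### Calculus of bundled 2-cells -/

/-- A 2-cell together with its source and target 1-cells. Equality of bundled 2-cells is equality
of 2-cells up to identity 2-cells between equal 1-cells. -/
structure Cell {K : Type u} [Bicategory.{w, v} K] (a b : K) where
  src : a ⟶ b
  tgt : a ⟶ b
  hom : src ⟶ tgt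

namespace Cell

section

variable {K : Type u} [Bicategory.{w, v} K] {a b c d : K}

/-- The bundled 2-cell of a 2-cell. -/
abbrev of {f g : a ⟶ b} (α : f ⟶ g) : Cell a b := ⟨f, g, α⟩

/-- The bundled identity 2-cell. -/
abbrev one (f : a ⟶ b) : Cell a b := ⟨f, f, 𝟙 f⟩

theorem of_injective {f g : a ⟶ b} {α β : f ⟶ g} (h : of α = of β) : α = β := by
  injection h

theorem of_eqToHom {f g : a ⟶ b} (h : f = g) : of (eqToHom h) = one f := by
  subst h; rfl

theorem of_eqToHom_comp_eqToHom {f f' g' g : a ⟶ b} (h : f = f') (α : f' ⟶ g') (h' : g' = g) :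
    of (eqToHom h ≫ α ≫ eqToHom h') = of α := by
  subst h h'; simp

/-- Vertical composition, in diagrammatic order. -/
def vcomp (x y : Cell a b) (h : x.tgt = y.src) : Cell a b :=
  ⟨x.src, y.tgt, x.hom ≫ eqToHom h ≫ y.hom⟩

@[simp] theorem vcomp_src (x y : Cell a b) (h : x.tgt = y.src) : (vcomp x y h).src = x.src := rfl

@[simp] theorem vcomp_tgt (x y : Cell a b) (h : x.tgt = y.src) : (vcomp x y h).tgt = y.tgt := rfl

theorem of_comp {f g h : a ⟶ b} (α : f ⟶ g) (β : g ⟶ h) :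
    of (α ≫ β) = vcomp (of α) (of β) rfl := by
  simp [vcomp]

@[simp] theorem one_vcomp {f : a ⟶ b} (y : Cell a b) (h : f = y.src) :
    vcomp (one f) y h = y := by
  subst h; simp [vcomp]

@[simp] theorem vcomp_one {f : a ⟶ b} (x : Cell a b) (h : x.tgt = f) :
    vcomp x (one f) h = x := by
  subst h; simp [vcomp]

@[simp] theorem vcomp_assoc (x y z : Cell a b) (h : x.tgt = y.src) (h' : y.tgt = z.src) :
    vcomp (vcomp x y h) z h' = vcomp x (vcomp y z h') h := by
  simp [vcomp]

theorem vcomp_congr {x y x' y' : Cell a b} (hx : x = x') (hy : y = y') (h : x.tgt = y.src) :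
    vcomp x y h = vcomp x' y' (by rw [← hx, ← hy, h]) := by
  subst hx hy; rfl

/-- Plays the role of `reassoc`: composability is a proof argument, so replacing an initial segment
of a longer composite has to carry that proof along. -/
theorem vcomp_reassoc {x y x' y' : Cell a b} {h : x.tgt = y.src} {h' : x'.tgt = y'.src}
    (e : vcomp x y h = vcomp x' y' h') (z : Cell a b) (hz : y.tgt = z.src) :
    vcomp x (vcomp y z hz) h =
      vcomp x' (vcomp y' z ((congrArg tgt e).symm.trans hz)) h' := by
  have : vcomp (vcomp x y h) z hz = vcomp (vcomp x' y' h') z ((congrArg tgt e).symm.trans hz) := by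
    simp only [e]
  exact (vcomp_assoc _ _ _ _ _).symm.trans (this.trans (vcomp_assoc _ _ _ _ _))

theorem vcomp_reassoc_one {x y : Cell a b} {f : a ⟶ b} {h : x.tgt = y.src}
    (e : vcomp x y h = one f) (z : Cell a b) (hz : y.tgt = z.src) :
    vcomp x (vcomp y z hz) h = z := by
  have : vcomp (vcomp x y h) z hz = vcomp (one f) z ((congrArg tgt e).symm.trans hz) := by
    simp only [e]
  simpa only [vcomp_assoc, one_vcomp] using this

/-- Pure cancellation: from `x y z = t` follows `z t⁻¹ = y⁻¹ x⁻¹`. It turns the coherence law of a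
pseudomorphism into the law for the inverse structure 2-cell. -/
theorem vcomp_eq_vcomp_of_inverse {x x' y y' z t t' : Cell a b} {f g k : a ⟶ b}
    {hx : x'.tgt = x.src} {hy : y'.tgt = y.src} {ht : t.tgt = t'.src} {hxy : x.tgt = y.src}
    {hyz : y.tgt = z.src} (ex : vcomp x' x hx = one f) (ey : vcomp y' y hy = one g)
    (et : vcomp t t' ht = one k) (e : vcomp x (vcomp y z hyz) hxy = t)
    (h : y'.tgt = x'.src) (h' : z.tgt = t'.src) : vcomp y' x' h = vcomp z t' h' := by
  have e₁ : vcomp x (vcomp y (vcomp z t' h') hyz) hxy = one k := by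
    subst e
    exact (vcomp_congr rfl (vcomp_assoc y z t' hyz h').symm hxy).trans
      ((vcomp_assoc x (vcomp y z hyz) t' hxy h').symm.trans et)
  have e₂ : vcomp y (vcomp z t' h') hyz = x' :=
    (vcomp_reassoc_one ex (vcomp y (vcomp z t' h') hyz) hxy).symm.trans ((vcomp_congr rfl e₁ _).trans (vcomp_one _ _))
  exact (vcomp_congr rfl e₂.symm h).trans (vcomp_reassoc_one ey (vcomp z t' h') hyz)

/-- Whiskering on both sides. -/
def whisk (p : a ⟶ b) (x : Cell b c) (q : c ⟶ d) : Cell a d :=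
  ⟨p ≫ x.src ≫ q, p ≫ x.tgt ≫ q, p ◁ x.hom ▷ q⟩

@[simp] theorem whisk_src (p : a ⟶ b) (x : Cell b c) (q : c ⟶ d) :
    (whisk p x q).src = p ≫ x.src ≫ q := rfl

@[simp] theorem whisk_tgt (p : a ⟶ b) (x : Cell b c) (q : c ⟶ d) :
    (whisk p x q).tgt = p ≫ x.tgt ≫ q := rfl

@[simp] theorem whisk_one (p : a ⟶ b) (f : b ⟶ c) (q : c ⟶ d) :
    whisk p (one f) q = one (p ≫ f ≫ q) := by
  simp [whisk]

@[simp] theorem whisk_vcomp (p : a ⟶ b) (x y : Cell b c) (h : x.tgt = y.src) (q : c ⟶ d) :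
    whisk p (vcomp x y h) q = vcomp (whisk p x q) (whisk p y q)
      (by rw [whisk_tgt, whisk_src, h]) := by
  simp [whisk, vcomp]

theorem of_hom_inv {f g : a ⟶ b} (i : f ≅ g) : vcomp (of i.hom) (of i.inv) rfl = one f := by
  simp [vcomp]

theorem of_inv_hom {f g : a ⟶ b} (i : f ≅ g) : vcomp (of i.inv) (of i.hom) rfl = one g := by
  simp [vcomp]

theorem whisk_hom_inv (p : a ⟶ b) {f g : b ⟶ c} (i : f ≅ g) (q : c ⟶ d) :
    vcomp (whisk p (of i.hom) q) (whisk p (of i.inv) q) rfl = one (p ≫ f ≫ q) := by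
  rw [← whisk_vcomp _ (of i.hom) (of i.inv) rfl, of_hom_inv, whisk_one]

theorem whisk_inv_hom (p : a ⟶ b) {f g : b ⟶ c} (i : f ≅ g) (q : c ⟶ d) :
    vcomp (whisk p (of i.inv) q) (whisk p (of i.hom) q) rfl = one (p ≫ g ≫ q) := by
  rw [← whisk_vcomp _ (of i.inv) (of i.hom) rfl, of_inv_hom, whisk_one]

theorem vcomp_whisk_hom_cancel {p : a ⟶ b} {f g : b ⟶ c} (i : f ≅ g) {q : c ⟶ d} {x y : Cell a d}
    {h : x.tgt = p ≫ f ≫ q} {h' : y.tgt = p ≫ f ≫ q}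
    (e : vcomp x (whisk p (of i.hom) q) h = vcomp y (whisk p (of i.hom) q) h') : x = y := by
  have := vcomp_reassoc e (whisk p (of i.inv) q) rfl
  simpa only [whisk_hom_inv, vcomp_one] using this

/-- A left inverse of an invertible 2-cell is a right inverse. -/
theorem vcomp_eq_one_of_iso {f g : a ⟶ b} (i : f ≅ g) (y : Cell a b) (h : g = y.src)
    (e : vcomp (of i.hom) y h = one f) (h' : y.tgt = f) : vcomp y (of i.hom) h' = one g := by
  obtain ⟨s, t, y⟩ := y
  dsimp only at h h'
  subst h h'
  have : i.hom ≫ y = 𝟙 _ := of_injective (by simpa [vcomp] using e)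
  have : y = i.inv := by simpa using (Iso.eq_inv_comp i).2 this
  subst this
  simp [vcomp]

theorem of_inv_congr {f g f' g' : a ⟶ b} (i : f ≅ g) (j : f' ≅ g') (e : of i.hom = of j.hom) :
    of i.inv = of j.inv := by
  obtain rfl : f = f' := congrArg src e
  obtain rfl : g = g' := congrArg tgt e
  obtain rfl : i = j := Iso.ext (of_injective e)
  rfl

end

section

variable {K : Type u} [Bicategory.{w, v} K] [Bicategory.Strict K] {a b c d : K}

@[simp] theorem whisk_id (x : Cell a b) : whisk (𝟙 a) x (𝟙 b) = x := by
  obtain ⟨s, t, α⟩ := x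
  have h (f : a ⟶ b) : 𝟙 a ≫ f ≫ 𝟙 b = f := by rw [Strict.id_comp, Strict.comp_id]
  refine Eq.trans ?_ (of_eqToHom_comp_eqToHom (h s) α (h t).symm)
  simp [whisk, Strict.leftUnitor_eqToIso, Strict.rightUnitor_eqToIso]

theorem of_whiskerLeft (f : a ⟶ b) {g h : b ⟶ c} (α : g ⟶ h) :
    of (f ◁ α) = whisk f (of α) (𝟙 c) := by
  have e (g : b ⟶ c) : f ≫ g ≫ 𝟙 c = f ≫ g := by rw [Strict.comp_id]
  have := of_eqToHom_comp_eqToHom (e g) (f ◁ α) (e h).symm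
  rw [← this]
  simp [whisk, Strict.rightUnitor_eqToIso]

theorem of_whiskerRight {f g : a ⟶ b} (α : f ⟶ g) (h : b ⟶ c) :
    of (α ▷ h) = whisk (𝟙 a) (of α) h := by
  have e (g : a ⟶ b) : 𝟙 a ≫ g ≫ h = g ≫ h := by rw [Strict.id_comp]
  have := of_eqToHom_comp_eqToHom (e f) (α ▷ h) (e g).symm
  rw [← this]
  simp [whisk, Strict.leftUnitor_eqToIso]

-- Gives the normal form of the calculus: every whiskered 2-cell becomes a single `whisk`, so
-- comparing two of them reduces to comparing 1-cells.
@[simp] theorem whisk_whisk {a' d' : K} (p' : a' ⟶ a) (p : a ⟶ b) (x : Cell b c) (q : c ⟶ d)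
    (q' : d ⟶ d') : whisk p' (whisk p x q) q' = whisk (p' ≫ p) x (q ≫ q') := by
  obtain ⟨s, t, α⟩ := x
  have e (g : b ⟶ c) : p' ≫ (p ≫ g ≫ q) ≫ q' = (p' ≫ p) ≫ g ≫ q ≫ q' := by
    simp only [Strict.assoc]
  have := of_eqToHom_comp_eqToHom (e s).symm (p' ◁ (p ◁ α ▷ q) ▷ q') (e t)
  simp only [whisk]
  refine this.symm.trans ?_
  simp [Strict.associator_eqToIso]

/-- Interchange of two 2-cells separated by a 1-cell. -/
theorem exchange {a' b' c' : K} (p : a' ⟶ a) {f f' : a ⟶ b} (α : f ⟶ f') (r : b ⟶ b')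
    {g g' : b' ⟶ c} (β : g ⟶ g') (q : c ⟶ c') :
    vcomp (whisk p (of α) (r ≫ g ≫ q)) (whisk (p ≫ f' ≫ r) (of β) q)
        (by simp only [whisk_tgt, whisk_src, Strict.assoc]) =
      vcomp (whisk (p ≫ f ≫ r) (of β) q) (whisk p (of α) (r ≫ g' ≫ q))
        (by simp only [whisk_tgt, whisk_src, Strict.assoc]) := by
  have h := congrArg (fun t => whisk p (of t) q) (whisker_exchange α (r ◁ β))
  simp only [of_comp, of_whiskerLeft, of_whiskerRight, whisk_vcomp, whisk_whisk, Strict.comp_id,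
    Strict.id_comp, Strict.assoc] at h
  simpa only [Strict.assoc] using h.symm

end

/-- The action of a 2-functor on bundled 2-cells. -/
def map {B : Type u₁} [Bicategory.{w₁, v₁} B] {C : Type u₂} [Bicategory.{w₂, v₂} C]
    (F : StrictPseudofunctor B C) {a b : B} (x : Cell a b) : Cell (F.obj a) (F.obj b) :=
  ⟨F.map x.src, F.map x.tgt, F.map₂ x.hom⟩

section

variable {B : Type u₁} [Bicategory.{w₁, v₁} B] {C : Type u₂} [Bicategory.{w₂, v₂} C]
  (F : StrictPseudofunctor B C) {a b c d : B}

@[simp] theorem map_src (x : Cell a b) : (map F x).src = F.map x.src := rfl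

@[simp] theorem map_tgt (x : Cell a b) : (map F x).tgt = F.map x.tgt := rfl

theorem of_map₂ {f g : a ⟶ b} (α : f ⟶ g) : of (F.map₂ α) = map F (of α) := rfl

@[simp] theorem map_one (f : a ⟶ b) : map F (one f) = one (F.map f) := by
  simp [map]

@[simp] theorem map_vcomp (x y : Cell a b) (h : x.tgt = y.src) :
    map F (vcomp x y h) = vcomp (map F x) (map F y) (congrArg F.map h) := by
  simp [map, vcomp, PrelaxFunctor.map₂_eqToHom]

@[simp] theorem map_whisk (p : a ⟶ b) (x : Cell b c) (q : c ⟶ d) :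
    map F (whisk p x q) = whisk (F.map p) (map F x) (F.map q) := by
  obtain ⟨s, t, α⟩ := x
  have e (g : b ⟶ c) : F.map (p ≫ g ≫ q) = F.map p ≫ F.map g ≫ F.map q := by
    simp only [F.map_comp]
  have := of_eqToHom_comp_eqToHom (e s) (F.map p ◁ F.map₂ α ▷ F.map q) (e t).symm
  simp only [map, whisk]
  refine Eq.trans ?_ this
  simp [F.map₂_whisker_left, F.map₂_whisker_right, F.mapComp_eq_eqToIso]

end

end Cell

theorem comp_reassoc {K : Type u} [Bicategory.{w, v} K] [Bicategory.Strict K] {a b c d : K}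
    {f : a ⟶ b} {g : b ⟶ c} {k : a ⟶ c} (h : f ≫ g = k) (l : c ⟶ d) : f ≫ g ≫ l = k ≫ l := by
  rw [← Strict.assoc, h]

open Cell

/-! ### Fillers and adjoint retractions -/

section Factorization

variable {K : Type u} [Bicategory.{w, v} K] [Bicategory.Strict K] {E M : MorphismProperty K}

namespace IsEnhancedFactorizationSystem

theorem exists_filler (h : IsEnhancedFactorizationSystem E M) {A X B Y : K} {e : A ⟶ X}
    {m : B ⟶ Y} (he : E e) (hm : M m) {v : A ⟶ B} {u : X ⟶ Y} (φ : e ≫ u ≅ v ≫ m) :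
    ∃ (w : X ⟶ B) (ψ : u ≅ w ≫ m), e ≫ w = v ∧ whisk e (of ψ.hom) (𝟙 Y) = of φ.hom := by
  obtain ⟨⟨w, ψ⟩, ⟨hw, hψ⟩, -⟩ := h.fill e m v u he hm φ
  refine ⟨w, ψ, hw, ?_⟩
  have := congrArg of hψ
  simpa only [of_comp, of_eqToHom, vcomp_one, of_whiskerLeft] using this

theorem filler_unique (h : IsEnhancedFactorizationSystem E M) {A X B Y : K} {e : A ⟶ X}
    {m : B ⟶ Y} (he : E e) (hm : M m) {u : X ⟶ Y} {w w' : X ⟶ B} (ψ : u ≅ w ≫ m)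
    (ψ' : u ≅ w' ≫ m) (hw : e ≫ w = e ≫ w')
    (hψ : whisk e (of ψ.hom) (𝟙 Y) = whisk e (of ψ'.hom) (𝟙 Y)) :
    w = w' ∧ of ψ.hom = of ψ'.hom := by
  have h := (h.fill e m (e ≫ w) u he hm
      (whiskerLeftIso e ψ ≪≫ eqToIso (Strict.assoc e w m).symm)).unique
    (y₁ := ⟨w, ψ⟩) (y₂ := ⟨w', ψ'⟩) ⟨rfl, rfl⟩ ⟨hw.symm, of_injective (by
      simp only [Iso.trans_hom, whiskerLeftIso_hom, eqToIso.hom, of_comp, of_eqToHom, vcomp_one,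
        of_whiskerLeft, hψ])⟩
  injection h with h₁ h₂
  subst h₁
  obtain rfl := eq_of_heq h₂
  exact ⟨rfl, rfl⟩

end IsEnhancedFactorizationSystem

/-- A retraction `m` with section `n` and `n ∘ m ≅ 1` is part of an adjoint equivalence whose
other 2-cell is the identity. -/
theorem exists_adjoint_retraction {X Y : K} {m : Y ⟶ X} {n : X ⟶ Y} (hnm : n ≫ m = 𝟙 X)
    (i : m ≫ n ≅ 𝟙 Y) : ∃ β : 𝟙 Y ≅ m ≫ n, whisk n (of β.hom) (𝟙 Y) = one n ∧
      whisk (𝟙 Y) (of β.hom) m = one m := by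
  have hnm' {Z : K} (k : X ⟶ Z) : n ≫ m ≫ k = k := by
    rw [← Strict.assoc, hnm, Strict.id_comp]
  -- Interchange of `i` with itself, followed by `m`; `n ≫ m = 𝟙` makes both sides end in `i ▷ m`,
  -- which cancels.
  have hm : whisk (𝟙 Y) (of i.hom) m = whisk (m ≫ n) (of i.hom) m := by
    have := exchange (𝟙 Y) i.hom (𝟙 Y) i.hom m
    simp only [Strict.id_comp, Strict.comp_id, Strict.assoc, hnm] at this
    exact vcomp_whisk_hom_cancel i this
  -- The standard correction `β = i⁻¹ · (m ≫ n) ◁ i`. Whiskered by `n` it collapses because `n ≫ m =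
  -- 𝟙`; whiskered by `m` it collapses by `hm`.
  refine ⟨i.symm ≪≫ eqToIso (by simp only [Strict.assoc, hnm']) ≪≫
    whiskerLeftIso (m ≫ n) i ≪≫ eqToIso (Strict.comp_id _), ?_, ?_⟩
  · have := whisk_inv_hom n i (𝟙 Y)
    simpa [of_comp, of_eqToHom, of_whiskerLeft, Strict.associator_eqToIso, Strict.comp_id, hnm'] using this
  · have := whisk_inv_hom (𝟙 Y) i m
    simpa [of_comp, of_eqToHom, of_whiskerLeft, Strict.associator_eqToIso, Strict.comp_id,
      Strict.id_comp, ← hm] using this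

end Factorization

/-! ### The pseudoalgebra axioms in bundled form -/

namespace PsAlg

variable {K : Type u} [Bicategory.{w, v} K] [Bicategory.Strict K] {T : TwoMonad K}

theorem whisk_ι_φ (X : PsAlg T) :
    whisk (T.ι (T.obj X.carrier)) (of X.φ.hom) (𝟙 _) = one X.act := by
  have := congrArg of X.ι_φ
  rw [of_whiskerLeft] at this
  rw [this, of_eqToHom, comp_reassoc (T.ι_naturality X.act).symm, Strict.assoc, X.unit,
    Strict.comp_id]

theorem whisk_map_ι_φ (X : PsAlg T) :
    whisk (T.map (T.ι X.carrier)) (of X.φ.hom) (𝟙 _) = one X.act := by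
  have := congrArg of X.map_ι_φ
  rw [of_whiskerLeft] at this
  rw [this, of_eqToHom, comp_reassoc (T.map_comp _ _).symm, X.unit, T.map_id, Strict.id_comp]

theorem whisk_φ_φ (X : PsAlg T) :
    vcomp (whisk (T.map (T.map X.act)) (of X.φ.hom) (𝟙 _))
        (whisk (T.μ (T.obj X.carrier)) (of X.φ.hom) (𝟙 _))
        (by simp only [whisk_tgt, whisk_src, ← Strict.assoc, T.μ_naturality]) =
      vcomp (whisk (𝟙 _) ((of X.φ.hom).map T.functor) X.act)
        (whisk (T.map (T.μ X.carrier)) (of X.φ.hom) (𝟙 _))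
        (by simp only [whisk_tgt, whisk_src, map_tgt, T.functor.map_comp, Strict.assoc,
          Strict.id_comp, Strict.comp_id]) := by
  have := congrArg of X.φ_φ
  simpa only [of_comp, of_eqToHom, of_whiskerLeft, of_whiskerRight, one_vcomp, vcomp_one,
    of_map₂] using this

/-- The coherence condition of a pseudomorphism in terms of bundled 2-cells. -/
theorem whisk_ζ_ζ_iff {X Y : PsAlg T} (f : X.carrier ⟶ Y.carrier)
    (ζ : T.map f ≫ Y.act ≅ X.act ≫ f) :
    (eqToHom (by rw [T.map_comp, Strict.assoc]) ≫ T.map₂ ζ.hom ▷ Y.act ≫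
      eqToHom (by rw [T.map_comp, Strict.assoc]) ≫ T.map X.act ◁ ζ.hom ≫
        eqToHom (by rw [Strict.assoc]) ≫ X.φ.hom ▷ f ≫ eqToHom (by rw [Strict.assoc]) =
    T.map (T.map f) ◁ Y.φ.hom ≫
      eqToHom (by rw [← Strict.assoc, T.μ_naturality, Strict.assoc]) ≫ T.μ X.carrier ◁ ζ.hom) ↔
    vcomp (whisk (𝟙 _) ((of ζ.hom).map T.functor) Y.act)
      (vcomp (whisk (T.map X.act) (of ζ.hom) (𝟙 _)) (whisk (𝟙 _) (of X.φ.hom) f)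
        (by simp only [whisk_tgt, whisk_src, Strict.assoc, Strict.id_comp, Strict.comp_id]))
        (by simp only [whisk_tgt, whisk_src, vcomp_src, map_tgt, T.functor.map_comp, Strict.assoc,
          Strict.id_comp, Strict.comp_id]) =
    vcomp (whisk (T.map (T.map f)) (of Y.φ.hom) (𝟙 _)) (whisk (T.μ X.carrier) (of ζ.hom) (𝟙 _))
      (by simp only [whisk_tgt, whisk_src, ← Strict.assoc, T.μ_naturality]) := by
  refine Iff.trans ⟨congrArg of, of_injective⟩ ?_
  simp only [of_comp, of_eqToHom, of_whiskerLeft, of_whiskerRight, one_vcomp, vcomp_one,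
    of_map₂]

/-- The normality condition of a pseudomorphism in terms of bundled 2-cells. -/
theorem whisk_ι_ζ_iff {X Y : PsAlg T} (f : X.carrier ⟶ Y.carrier)
    (ζ : T.map f ≫ Y.act ≅ X.act ≫ f) :
    (T.ι X.carrier ◁ ζ.hom = eqToHom (by
      rw [← Strict.assoc, ← T.ι_naturality, Strict.assoc, Y.unit, ← Strict.assoc, X.unit,
        Strict.comp_id, Strict.id_comp])) ↔
      whisk (T.ι X.carrier) (of ζ.hom) (𝟙 _) = one f := by
  refine Iff.trans ⟨congrArg of, of_injective⟩ ?_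
  rw [of_whiskerLeft, of_eqToHom, comp_reassoc (T.ι_naturality f).symm, Strict.assoc, Y.unit,
    Strict.comp_id]

end PsAlg

/-! ### The strict algebra on the middle object of the factorization -/

section Strictification

variable {K : Type u} [Bicategory.{w, v} K] [Bicategory.Strict K] {T : TwoMonad K}
  {E M : MorphismProperty K}

/-- The action of a pseudoalgebra factors through a strict algebra along a pseudomorphism. -/
theorem exists_strict_factorization (h : IsEnhancedFactorizationSystem E M) (hT : T.Preserves E)
    (X : PsAlg T) : ∃ (A : AlgSt T) (e : T.obj X.carrier ⟶ A.carrier) (m : PsAlg.Hom A.toPsAlg X),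
      E e ∧ M m.f ∧ e ≫ m.f = X.act ∧ T.map e ≫ A.act = T.μ X.carrier ≫ e ∧
        whisk (T.map e) (of m.ζ.hom) (𝟙 _) = of X.φ.hom := by
  obtain ⟨I, e, m, he, hm, hem⟩ := h.factor X.act
  -- The square is `φ` itself, with `act` split as `e ≫ m` at both ends.
  obtain ⟨θ, ψ, hθ, hψ⟩ := h.exists_filler (hT e he) hm (v := T.μ X.carrier ≫ e)
    (u := T.map m ≫ X.act)
    (eqToIso (by rw [← Strict.assoc, ← T.map_comp, hem]) ≪≫ X.φ ≪≫
      eqToIso (by rw [Strict.assoc, hem]))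
  replace hψ : whisk (T.map e) (of ψ.hom) (𝟙 _) = of X.φ.hom := by
    rw [hψ]
    simp [of_comp, of_eqToHom]
  have hψ' {Y Z : K} (p : Y ⟶ _) (q : _ ⟶ Z) :
      whisk (p ≫ T.map e) (of ψ.hom) q = whisk p (of X.φ.hom) q := by
    rw [← hψ, whisk_whisk, Strict.id_comp]
  have hψT : whisk (T.map (T.map e)) ((of ψ.hom).map T.functor) X.act =
      whisk (𝟙 _) ((of X.φ.hom).map T.functor) X.act := by
    rw [← hψ, map_whisk, whisk_whisk, Strict.id_comp, T.functor.map_id, Strict.id_comp]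
  have heι : e ≫ T.ι I = T.ι _ ≫ T.map e := T.ι_naturality e
  have heμ : T.map (T.map e) ≫ T.μ I = T.μ _ ≫ T.map e := T.μ_naturality e
  have hTm : T.map (T.map e) ≫ T.map (T.map m) = T.map (T.map X.act) := by
    rw [← T.map_comp, ← T.map_comp, hem]
  have hTθ : T.map (T.map e) ≫ T.map θ = T.map (T.μ _) ≫ T.map e := by
    rw [← T.map_comp, hθ, T.map_comp]
  have hιm : m = T.ι I ≫ T.map m ≫ X.act := by
    rw [← Strict.assoc, ← T.ι_naturality, Strict.assoc, X.unit, Strict.comp_id]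
  -- Unit law: restricted along `e`, the 2-cell of the first filler becomes `φ` whiskered by `ι` at
  -- `TX`, an identity by normality.
  obtain ⟨hunit, hunit'⟩ := h.filler_unique he hm (w := T.ι I ≫ θ) (w' := 𝟙 I) (u := m)
    (eqToIso hιm ≪≫ whiskerLeftIso (T.ι I) ψ ≪≫ eqToIso (Strict.assoc _ _ _).symm)
    (eqToIso (Strict.id_comp _).symm)
    (by rw [comp_reassoc heι, Strict.assoc, hθ, comp_reassoc (T.ι_μ _), Strict.id_comp,
      Strict.comp_id])
    (by
      simp only [Iso.trans_hom, eqToIso.hom, whiskerLeftIso_hom, of_comp, of_eqToHom, one_vcomp,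
        vcomp_one, of_whiskerLeft, whisk_whisk, heι, hψ', Strict.comp_id, X.whisk_ι_φ, whisk_one,
        hem])
  -- Associativity: restricted along `T(Te)`, the two 2-cells become the two sides of the coherence
  -- law of `φ`. Their equality before restriction, `hassoc'`, is the coherence law of `(m, ψ)`.
  obtain ⟨hassoc, hassoc'⟩ := h.filler_unique (hT _ (hT e he)) hm (w := T.map θ ≫ θ)
    (w' := T.μ I ≫ θ) (u := T.map (T.map m) ≫ T.map X.act ≫ X.act)
    (eqToIso (by rw [T.functor.map_comp, Strict.assoc]) ≪≫
      whiskerRightIso (T.functor.map₂Iso ψ) X.act ≪≫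
      eqToIso (by rw [T.functor.map_comp, Strict.assoc]) ≪≫ whiskerLeftIso (T.map θ) ψ ≪≫
      eqToIso (by rw [Strict.assoc]))
    (whiskerLeftIso (T.map (T.map m)) X.φ ≪≫
      eqToIso (by rw [← Strict.assoc, T.μ_naturality, Strict.assoc]) ≪≫
      whiskerLeftIso (T.μ I) ψ ≪≫ eqToIso (by rw [Strict.assoc]))
    (by rw [comp_reassoc hTθ, Strict.assoc, hθ, comp_reassoc heμ, Strict.assoc, hθ,
      comp_reassoc (T.μ_μ _), Strict.assoc])
    (by
      simp only [Iso.trans_hom, eqToIso.hom, whiskerLeftIso_hom, whiskerRightIso_hom,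
        PrelaxFunctor.map₂Iso_hom, of_comp, of_eqToHom, one_vcomp, vcomp_one, of_whiskerLeft,
        of_whiskerRight, of_map₂, whisk_vcomp, whisk_whisk, Strict.comp_id, hψT, hTθ, hTm, heμ, hψ']
      exact X.whisk_φ_φ.symm)
  simp only [Iso.trans_hom, eqToIso.hom, whiskerLeftIso_hom, whiskerRightIso_hom,
    PrelaxFunctor.map₂Iso_hom, of_comp, of_eqToHom, one_vcomp, vcomp_one, of_whiskerLeft,
    of_whiskerRight, of_map₂] at hunit' hassoc'
  refine ⟨⟨I, θ, hunit, hassoc⟩, e, ⟨m, ψ, ?_, ?_⟩, he, hm, hem, hθ, hψ⟩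
  · exact (PsAlg.whisk_ι_ζ_iff (X := AlgSt.toPsAlg ⟨I, θ, hunit, hassoc⟩) m ψ).2 hunit'
  · refine (PsAlg.whisk_ζ_ζ_iff (X := AlgSt.toPsAlg ⟨I, θ, hunit, hassoc⟩) m ψ).2 ?_
    simpa only [eqToIso.hom, of_eqToHom, whisk_one, vcomp_one] using hassoc'

end Strictification

/-! ### Strictification data and the section as a pseudomorphism -/

variable {K : Type u} [Bicategory.{w, v} K] [Bicategory.Strict K] {T : TwoMonad K}

/-- A factorization of the action of a pseudoalgebra through a strict algebra, by a pseudomorphism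
`m` that is an adjoint retract equivalence of underlying objects. -/
structure Strictification (X : PsAlg T) where
  alg : AlgSt T
  e : T.obj X.carrier ⟶ alg.carrier
  m : alg.carrier ⟶ X.carrier
  ζ : T.map m ≫ X.act ≅ alg.act ≫ m
  ι_ζ : whisk (T.ι alg.carrier) (of ζ.hom) (𝟙 _) = one m
  ζ_ζ : vcomp (whisk (𝟙 _) ((of ζ.hom).map T.functor) X.act)
      (whisk (T.map alg.act) (of ζ.hom) (𝟙 _))
      (by simp only [whisk_tgt, whisk_src, map_tgt, T.functor.map_comp, Strict.assoc,
          Strict.id_comp, Strict.comp_id]) =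
    vcomp (whisk (T.map (T.map m)) (of X.φ.hom) (𝟙 _)) (whisk (T.μ alg.carrier) (of ζ.hom) (𝟙 _))
      (by simp only [whisk_tgt, whisk_src, ← Strict.assoc, T.μ_naturality])
  e_m : e ≫ m = X.act
  map_e_act : T.map e ≫ alg.act = T.μ X.carrier ≫ e
  whisk_map_e_ζ : whisk (T.map e) (of ζ.hom) (𝟙 _) = of X.φ.hom
  β : 𝟙 alg.carrier ≅ m ≫ T.ι X.carrier ≫ e
  whisk_section_β : whisk (T.ι X.carrier ≫ e) (of β.hom) (𝟙 _) = one (T.ι X.carrier ≫ e)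
  whisk_β_m : whisk (𝟙 _) (of β.hom) m = one m

theorem exists_strictification {E M : MorphismProperty K}
    (h : IsRigidEnhancedFactorizationSystem E M) (hT : T.Preserves E) (X : PsAlg T) :
    ∃ S : Strictification X, E S.e := by
  obtain ⟨A, e, m, he, hm, hem, hθ, hζ⟩ :=
    exists_strict_factorization h.toIsEnhancedFactorizationSystem hT X
  have hn : (T.ι X.carrier ≫ e) ≫ m.f = 𝟙 _ := by rw [Strict.assoc, hem, X.unit]
  -- The unit law of `X` makes `ι ≫ e` a section of `m`, which is what rigidity needs.
  obtain ⟨i⟩ := h.rigid m.f hm (T.ι X.carrier ≫ e) ⟨eqToIso hn⟩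
  obtain ⟨β, h₁, h₂⟩ := exists_adjoint_retraction hn i
  have hmι := (PsAlg.whisk_ι_ζ_iff m.f m.ζ).1 m.ι_ζ
  have hmζ := (PsAlg.whisk_ζ_ζ_iff m.f m.ζ).1 m.ζ_ζ
  simp only [eqToIso.hom, of_eqToHom, whisk_one, vcomp_one] at hmζ
  exact ⟨⟨A, e, m.f, m.ζ, hmι, hmζ, hem, hθ, hζ, β, h₁, h₂⟩, he⟩

namespace Strictification

variable {X : PsAlg T} (S : Strictification X)

/-- The retraction as a pseudomorphism. -/
def counit : PsAlg.Hom S.alg.toPsAlg X where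
  f := S.m
  ζ := S.ζ
  ι_ζ := (PsAlg.whisk_ι_ζ_iff (X := S.alg.toPsAlg) S.m S.ζ).2 S.ι_ζ
  ζ_ζ := (PsAlg.whisk_ζ_ζ_iff (X := S.alg.toPsAlg) S.m S.ζ).2 (by
    simpa only [eqToIso.hom, of_eqToHom, whisk_one, vcomp_one] using S.ζ_ζ)

/-- Recovers `e` from the section. Hence `e ◁ β` has the right source to be a structure 2-cell, and
a strict map out of `alg` is determined on `e` by its restriction along the section. -/
theorem map_section_act : T.map (T.ι X.carrier ≫ S.e) ≫ S.alg.act = S.e := by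
  rw [T.map_comp, Strict.assoc, S.map_e_act, comp_reassoc (T.map_ι_μ _), Strict.id_comp]

theorem whisk_comp_map_e_ζ {Y Z : K} (p : Y ⟶ _) (q : _ ⟶ Z) :
    whisk (p ≫ T.map S.e) (of S.ζ.hom) q = whisk p (of X.φ.hom) q := by
  rw [← S.whisk_map_e_ζ, whisk_whisk, Strict.id_comp]

theorem whisk_β_m_comp {Y Z : K} (p : Y ⟶ _) (q : _ ⟶ Z) :
    whisk p (of S.β.hom) (S.m ≫ q) = one (p ≫ S.m ≫ q) := by
  have := congrArg (fun x => whisk p x q) S.whisk_β_m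
  simpa only [whisk_whisk, whisk_one, Strict.comp_id] using this

/-- Interchange of `Tβ` and `ζ`. One side is trivial: `Tβ` followed by `Tm` is an identity by the
triangle identity, and `ζ` preceded by `T(m ≫ ι ≫ e)` reduces to `φ` preceded by `Tι`. So `Tβ`,
whiskered by `act ≫ m`, is inverse to `ζ`. -/
theorem vcomp_ζ_map_β :
    vcomp (of S.ζ.hom) (whisk (𝟙 _) ((of S.β.hom).map T.functor) (S.alg.act ≫ S.m))
      (by simp only [whisk_src, map_src, T.functor.map_id, Strict.id_comp]) =
        one (T.map S.m ≫ X.act) := by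
  have h := exchange (𝟙 _) (T.map₂ S.β.hom) (𝟙 _) S.ζ.hom (𝟙 _)
  have h₁ : whisk (𝟙 _) ((of S.β.hom).map T.functor) (T.map S.m ≫ X.act) =
      one (T.map S.m ≫ X.act) := by
    have := congrArg (fun x => whisk (𝟙 _) (x.map T.functor) X.act) S.whisk_β_m
    simpa only [map_whisk, whisk_whisk, Cell.map_one, whisk_one, T.functor.map_id, Strict.id_comp]
      using this
  have h₂ : whisk (T.map (S.m ≫ T.ι X.carrier ≫ S.e)) (of S.ζ.hom) (𝟙 _) =
      one (T.map S.m ≫ X.act) := by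
    have := congrArg (fun x => whisk (T.map S.m) x (𝟙 _)) X.whisk_map_ι_φ
    rw [T.map_comp, T.map_comp, ← Strict.assoc, whisk_comp_map_e_ζ]
    simpa only [whisk_whisk, whisk_one, Strict.comp_id] using this
  simp only [Strict.id_comp, Strict.comp_id, of_map₂, T.functor.map_id, h₁, h₂, one_vcomp,
    whisk_id] at h
  exact h.symm

theorem vcomp_map_β_ζ :
    vcomp (whisk (𝟙 _) ((of S.β.hom).map T.functor) (S.alg.act ≫ S.m)) (of S.ζ.hom)
      (by
        rw [whisk_tgt, map_tgt, T.functor.map_comp, Strict.id_comp, Strict.assoc,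
          comp_reassoc S.map_section_act, S.e_m]) = one (S.alg.act ≫ S.m) :=
  vcomp_eq_one_of_iso S.ζ _ _ S.vcomp_ζ_map_β _

/-- The compatibility of `β` with the actions. -/
theorem vcomp_map_β_β_ζ :
    vcomp (whisk (𝟙 _) ((of S.β.hom).map T.functor) S.alg.act)
      (vcomp (whisk (T.map S.m ≫ S.e) (of S.β.hom) (𝟙 _))
        (whisk (𝟙 _) (of S.ζ.hom) (T.ι X.carrier ≫ S.e))
        (by simp only [whisk_tgt, whisk_src, Strict.assoc, Strict.id_comp, Strict.comp_id,
          comp_reassoc S.e_m]))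
      (by
        rw [whisk_tgt, vcomp_src, whisk_src, map_tgt, T.functor.map_comp, Strict.assoc,
          S.map_section_act, Strict.id_comp, Strict.comp_id, Strict.comp_id]) =
      whisk S.alg.act (of S.β.hom) (𝟙 _) := by
  -- Interchange moves `Tβ` past `β`, next to `ζ`, where `vcomp_map_β_ζ` cancels the two.
  have h := exchange (𝟙 _) (T.map₂ S.β.hom) S.alg.act S.β.hom (𝟙 _)
  have h' := congrArg (fun x => whisk (𝟙 _) x (T.ι X.carrier ≫ S.e)) S.vcomp_map_β_ζ
  have hn : T.map (S.m ≫ T.ι X.carrier ≫ S.e) ≫ S.alg.act = T.map S.m ≫ S.e := by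
    rw [T.map_comp, Strict.assoc, S.map_section_act]
  simp only [Strict.id_comp, Strict.comp_id, of_map₂, T.functor.map_id] at h
  simp only [hn] at h
  simp only [whisk_vcomp, whisk_whisk, whisk_one, Strict.id_comp, Strict.assoc] at h'
  rw [vcomp_reassoc h]
  simp only [h', vcomp_one]

/-- The section of `m` as a pseudomorphism. -/
def unit : PsAlg.Hom X S.alg.toPsAlg where
  f := T.ι X.carrier ≫ S.e
  -- Up to identities this is `e ◁ β`, from `e = T(ι ≫ e) ≫ act` to `e ≫ m ≫ ι ≫ e`. Normality is
  -- then the triangle identity at the section.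
  ζ := eqToIso (S.map_section_act.trans (Strict.comp_id _).symm) ≪≫ whiskerLeftIso S.e S.β ≪≫
    eqToIso (comp_reassoc S.e_m _)
  ι_ζ := by
    refine (PsAlg.whisk_ι_ζ_iff (X := X) (Y := S.alg.toPsAlg) _ _).2 ?_
    simp only [Iso.trans_hom, eqToIso.hom, whiskerLeftIso_hom, of_comp, of_eqToHom, one_vcomp,
      vcomp_one, of_whiskerLeft, whisk_whisk, Strict.comp_id, S.whisk_section_β]
  ζ_ζ := by
    refine (PsAlg.whisk_ζ_ζ_iff (X := X) (Y := S.alg.toPsAlg) _ _).2 ?_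
    -- Preceding by `Te` turns `ζ` into `φ` and the compatibility of `β` into the coherence law.
    have h := congrArg (fun x => whisk (T.map S.e) x (𝟙 _)) S.vcomp_map_β_β_ζ
    have hm {Z : K} (k : _ ⟶ Z) : T.map S.e ≫ T.map S.m ≫ k = T.map X.act ≫ k :=
      comp_reassoc (by rw [← T.map_comp, S.e_m]) _
    have hζ := S.whisk_comp_map_e_ζ (𝟙 _) (T.ι X.carrier ≫ S.e)
    simp only [Strict.id_comp] at hζ
    simp only [Iso.trans_hom, eqToIso.hom, whiskerLeftIso_hom, of_comp, of_eqToHom, one_vcomp,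
      vcomp_one, of_whiskerLeft, whisk_whisk, Strict.comp_id, Strict.id_comp, map_whisk,
      T.functor.map_id, whisk_one, whisk_vcomp, hm, hζ, S.map_e_act] at h ⊢
    exact h

theorem of_unit_ζ : of S.unit.ζ.hom = whisk S.e (of S.β.hom) (𝟙 _) := by
  simp only [unit, Iso.trans_hom, eqToIso.hom, whiskerLeftIso_hom, of_comp, of_eqToHom, one_vcomp,
    vcomp_one, of_whiskerLeft]

end Strictification

/-! ### Composites and isomorphisms of pseudomorphisms -/

namespace PsAlg

theorem of_comp_ζ {X Y Z : PsAlg T} (f : Hom X Y) (g : Hom Y Z) {x : Cell _ _} {y : Cell _ _}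
    (hx : of f.ζ.hom = x) (hy : of g.ζ.hom = y) :
    of (comp f g).ζ.hom = vcomp (whisk (T.map f.f) y (𝟙 _)) (whisk (𝟙 _) x g.f)
      (by
        subst hx hy
        simp only [whisk_tgt, whisk_src, Strict.assoc, Strict.id_comp, Strict.comp_id]) := by
  subst hx hy
  simp only [Iso.trans_hom, Iso.symm_hom, eqToIso.hom, whiskerLeftIso_hom, whiskerRightIso_hom,
    of_comp, of_eqToHom, one_vcomp, vcomp_one, of_whiskerLeft, of_whiskerRight,
    Strict.associator_eqToIso, eqToIso.inv]

theorem Hom.ext_iff_of {X Y : PsAlg T} {f g : Hom X Y} :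
    f = g ↔ f.f = g.f ∧ of f.ζ.hom = of g.ζ.hom := by
  refine ⟨by rintro rfl; exact ⟨rfl, rfl⟩, fun ⟨h, h'⟩ => Hom.ext h (of_injective ?_)⟩
  rw [of_eqToHom_comp_eqToHom, h']

/-- An algebra 2-cell whose underlying 2-cell is invertible is invertible. -/
def isoOfCell {X Y : PsAlg T} {f g : X ⟶ Y} (i : Hom.f f ≅ Hom.f g)
    (h : T.map₂ i.hom ▷ Y.act ≫ (Hom.ζ g).hom = (Hom.ζ f).hom ≫ X.act ◁ i.hom) : f ≅ g where
  hom := ⟨i.hom, h⟩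
  inv := ⟨i.inv, by
    have h₁ : T.map₂ i.inv ▷ Y.act ≫ T.map₂ i.hom ▷ Y.act = 𝟙 _ := by
      rw [← comp_whiskerRight, ← T.functor.map₂_comp]
      simp
    have h₂ : X.act ◁ i.hom ≫ X.act ◁ i.inv = 𝟙 _ := by
      rw [← Bicategory.whiskerLeft_comp]
      simp
    rw [← Category.comp_id (T.map₂ i.inv ▷ Y.act ≫ (Hom.ζ f).hom), ← h₂, Category.assoc,
      ← reassoc_of% h, reassoc_of% h₁]⟩
  hom_inv_id := hom₂_ext i.hom_inv_id
  inv_hom_id := hom₂_ext i.inv_hom_id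

end PsAlg

/-! ### The equivalence between a pseudoalgebra and its strictification -/

namespace Strictification

variable {X : PsAlg T} (S : Strictification X)

/-- The structure 2-cell of the composite has two factors: `ζ` preceded by `T(ι ≫ e)`, trivial by
normality of `φ`, and `β` between `e` and `m`, trivial by the triangle identity. -/
theorem unit_comp_counit : PsAlg.comp S.unit S.counit = PsAlg.id X := by
  refine PsAlg.Hom.ext_iff_of.2 ⟨?_, ?_⟩
  · change (T.ι X.carrier ≫ S.e) ≫ S.m = 𝟙 _
    rw [Strict.assoc, S.e_m, X.unit]
  · have h₁ : whisk (T.map (T.ι X.carrier ≫ S.e)) (of S.ζ.hom) (𝟙 _) = one X.act := by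
      rw [T.map_comp, whisk_comp_map_e_ζ, X.whisk_map_ι_φ]
    have h₂ : whisk (𝟙 _) (whisk S.e (of S.β.hom) (𝟙 _)) S.m = one X.act := by
      simpa only [whisk_whisk, Strict.id_comp, Strict.comp_id, S.e_m] using
        S.whisk_β_m_comp S.e (𝟙 _)
    refine (PsAlg.of_comp_ζ _ _ S.of_unit_ζ rfl).trans ((vcomp_congr h₁ h₂ _).trans ?_)
    simp only [one_vcomp, eqToIso.hom, of_eqToHom, T.map_id, Strict.id_comp]

/-- This is `vcomp_map_β_β_ζ` once the composite structure 2-cell is unfolded; it lifts `β` to an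
algebra 2-cell. -/
theorem map_β_comm : T.map₂ S.β.hom ▷ S.alg.act ≫ (PsAlg.comp S.counit S.unit).ζ.hom =
    (PsAlg.id S.alg.toPsAlg).ζ.hom ≫ S.alg.act ◁ S.β.hom := by
  refine of_injective (((of_comp _ _).trans ?_).trans (of_comp _ _).symm)
  have h : of (PsAlg.comp S.counit S.unit).ζ.hom = _ :=
    PsAlg.of_comp_ζ S.counit S.unit rfl S.of_unit_ζ
  refine (vcomp_congr (of_whiskerRight _ _) h _).trans ?_
  refine Eq.trans ?_ (vcomp_congr (of_eqToHom (g := S.alg.act ≫ 𝟙 _)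
    (by rw [T.map_id, Strict.id_comp, Strict.comp_id])) (of_whiskerLeft _ _) _).symm
  simp only [one_vcomp, of_map₂, whisk_whisk, Strict.comp_id]
  exact S.vcomp_map_β_β_ζ

/-- The component of the unit at a pseudoalgebra is an adjoint equivalence. -/
def equivalence : Bicategory.Equivalence X S.alg.toPsAlg :=
  -- Adjointification may change only the counit 2-cell, so the underlying 1-cell stays `S.unit` and
  -- no triangle identity has to be checked in `PsAlg T`.
  Equivalence.mkOfAdjointifyCounit (f := S.unit) (g := S.counit) (eqToIso S.unit_comp_counit.symm)
    (PsAlg.isoOfCell (f := 𝟙 S.alg.toPsAlg) (g := PsAlg.comp S.counit S.unit) S.β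
      S.map_β_comm).symm

theorem unit_comp_eq_iff {Y : AlgSt T} (g : AlgSt.Hom S.alg Y) (f : PsAlg.Hom X Y.toPsAlg) :
    PsAlg.comp S.unit g.toPsAlg = f ↔
      (T.ι X.carrier ≫ S.e) ≫ g.f = f.f ∧ whisk S.e (of S.β.hom) g.f = of f.ζ.hom := by
  have h : of (PsAlg.comp S.unit g.toPsAlg).ζ.hom = whisk S.e (of S.β.hom) g.f := by
    refine (PsAlg.of_comp_ζ _ _ S.of_unit_ζ (of_eqToHom g.comm)).trans ?_
    simp only [whisk_one, one_vcomp, whisk_whisk, Strict.id_comp]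
  rw [PsAlg.Hom.ext_iff_of, h]
  rfl

/-! ### The one-dimensional universal property -/

section

variable {Y : AlgSt T} {f : X.carrier ⟶ Y.carrier} {ζ : T.map f ≫ Y.act ≅ X.act ≫ f}

theorem whisk_ι_inv (hι : whisk (T.ι X.carrier) (of ζ.hom) (𝟙 _) = one f) :
    whisk (T.ι X.carrier) (of ζ.inv) (𝟙 _) = one f := by
  have h := whisk_hom_inv (T.ι X.carrier) ζ (𝟙 _)
  have h' := congrArg src hι
  simp only [whisk_src] at h'
  simpa only [hι, one_vcomp, h'] using h

/-- The coherence law solved for `ζ⁻¹`, the 2-cell of the square that is filled in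
`exists_strict_map`. -/
theorem vcomp_inv
    (hζ : vcomp (whisk (𝟙 _) ((of ζ.hom).map T.functor) Y.act)
      (vcomp (whisk (T.map X.act) (of ζ.hom) (𝟙 _)) (whisk (𝟙 _) (of X.φ.hom) f)
        (by simp only [whisk_tgt, whisk_src, Strict.assoc, Strict.id_comp, Strict.comp_id]))
        (by simp only [whisk_tgt, whisk_src, vcomp_src, map_tgt, T.functor.map_comp, Strict.assoc,
          Strict.id_comp, Strict.comp_id]) = whisk (T.μ X.carrier) (of ζ.hom) (𝟙 _)) :
    vcomp (whisk (T.map X.act) (of ζ.inv) (𝟙 _))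
      (whisk (𝟙 _) ((of ζ.inv).map T.functor) Y.act)
      (by simp only [whisk_tgt, whisk_src, map_src, T.functor.map_comp, Strict.assoc,
          Strict.id_comp, Strict.comp_id]) =
    vcomp (whisk (𝟙 _) (of X.φ.hom) f) (whisk (T.μ X.carrier) (of ζ.inv) (𝟙 _))
      (by simp only [whisk_tgt, whisk_src, Strict.assoc, Strict.id_comp, Strict.comp_id]) := by
  have h : vcomp (whisk (𝟙 _) ((of ζ.inv).map T.functor) Y.act)
      (whisk (𝟙 _) ((of ζ.hom).map T.functor) Y.act) rfl = one _ :=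
    whisk_inv_hom (𝟙 _) (T.functor.map₂Iso ζ) Y.act
  exact vcomp_eq_vcomp_of_inverse h (whisk_inv_hom (T.map X.act) ζ (𝟙 _))
    (whisk_hom_inv (T.μ X.carrier) ζ (𝟙 _)) hζ _ _

theorem exists_strict_map {E M : MorphismProperty K} (h : IsEnhancedFactorizationSystem E M)
    (hT : T.Preserves E) (he : E S.e)
    (hι : whisk (T.ι X.carrier) (of ζ.inv) (𝟙 _) = one f)
    (hζ : vcomp (whisk (T.map X.act) (of ζ.inv) (𝟙 _))
      (whisk (𝟙 _) ((of ζ.inv).map T.functor) Y.act)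
      (by simp only [whisk_tgt, whisk_src, map_src, T.functor.map_comp, Strict.assoc,
          Strict.id_comp, Strict.comp_id]) =
    vcomp (whisk (𝟙 _) (of X.φ.hom) f) (whisk (T.μ X.carrier) (of ζ.inv) (𝟙 _))
      (by simp only [whisk_tgt, whisk_src, Strict.assoc, Strict.id_comp, Strict.comp_id])) :
    ∃ g : AlgSt.Hom S.alg Y,
      (T.ι X.carrier ≫ S.e) ≫ g.f = f ∧ whisk S.e (of S.β.hom) g.f = of ζ.hom := by
  have hM : M (𝟙 Y.carrier) := h.right_of_iso _ (𝟙 _) (Strict.id_comp _) (Strict.id_comp _)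
  -- Up to isomorphism `g` must be `m ≫ f`. Filling against `𝟙`, which lies in `M`, replaces `m ≫ f`
  -- by an isomorphic 1-cell whose restriction along `e` is exactly `T f ≫ act`.
  obtain ⟨g, γ, heg, hγ⟩ : ∃ (g : S.alg.carrier ⟶ Y.carrier) (γ : S.m ≫ f ≅ g),
      S.e ≫ g = T.map f ≫ Y.act ∧ whisk S.e (of γ.hom) (𝟙 _) = of ζ.inv := by
    obtain ⟨g, γ, heg, hγ⟩ := h.exists_filler he hM (v := T.map f ≫ Y.act) (u := S.m ≫ f)
      (eqToIso (comp_reassoc S.e_m _) ≪≫ ζ.symm ≪≫ eqToIso (Strict.comp_id _).symm)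
    refine ⟨g, γ ≪≫ eqToIso (Strict.comp_id _), heg, ?_⟩
    simpa only [Iso.trans_hom, Iso.symm_hom, eqToIso.hom, of_comp, of_eqToHom, one_vcomp,
      vcomp_one] using hγ
  have hγ' {A B : K} (p : A ⟶ _) (q : _ ⟶ B) :
      whisk (p ≫ S.e) (of γ.hom) q = whisk p (of ζ.inv) q := by
    rw [← hγ, whisk_whisk, Strict.id_comp]
  have hγT : whisk (T.map S.e) ((of γ.hom).map T.functor) Y.act =
      whisk (𝟙 _) ((of ζ.inv).map T.functor) Y.act := by
    rw [← hγ, map_whisk, whisk_whisk, Strict.id_comp, T.functor.map_id, Strict.id_comp]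
  have hTm : T.map S.e ≫ T.map S.m = T.map X.act := by rw [← T.map_comp, S.e_m]
  have hTg : T.map S.e ≫ T.map g = T.map (T.map f) ≫ T.map Y.act := by
    rw [← T.map_comp, heg, T.map_comp]
  have hζ' := S.whisk_comp_map_e_ζ (𝟙 _) f
  rw [Strict.id_comp] at hζ'
  -- Strictness of `g`: both 1-cells come with an isomorphism from `Tm ≫ act ≫ f`, and restricted
  -- along `Te` these isomorphisms are the two sides of `hζ`.
  obtain ⟨hstrict, -⟩ := h.filler_unique (hT _ he) hM (w := T.map g ≫ Y.act)
    (w' := S.alg.act ≫ g) (u := T.map S.m ≫ X.act ≫ f)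
    (whiskerLeftIso (T.map S.m) ζ.symm ≪≫
      eqToIso (by rw [T.functor.map_comp, Strict.assoc]) ≪≫
      whiskerRightIso (T.functor.map₂Iso γ) Y.act ≪≫ eqToIso (Strict.comp_id _).symm)
    (eqToIso (Strict.assoc _ _ _).symm ≪≫ whiskerRightIso S.ζ f ≪≫
      eqToIso (Strict.assoc _ _ _) ≪≫ whiskerLeftIso S.alg.act γ ≪≫
      eqToIso (Strict.comp_id _).symm)
    (by rw [comp_reassoc hTg, Strict.assoc, Y.assoc, comp_reassoc (T.μ_naturality f),
      comp_reassoc S.map_e_act, Strict.assoc, Strict.assoc, heg])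
    (by
      simp only [Iso.trans_hom, Iso.symm_hom, eqToIso.hom, whiskerLeftIso_hom,
        whiskerRightIso_hom, PrelaxFunctor.map₂Iso_hom, of_comp, of_eqToHom, one_vcomp, vcomp_one,
        of_whiskerLeft, of_whiskerRight, of_map₂, whisk_vcomp, whisk_whisk, Strict.comp_id, hγT,
        hTm, hζ', S.map_e_act, hγ']
      exact hζ)
  have hn : (T.ι X.carrier ≫ S.e) ≫ g = f := by
    rw [Strict.assoc, heg, ← Strict.assoc, ← T.ι_naturality, Strict.assoc, Y.unit, Strict.comp_id]
  -- Interchange of `β` and `γ`, trivial on one side by the triangle identity and the normality of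
  -- `ζ⁻¹`. Preceding by `e`, where `γ` is `ζ⁻¹`, gives `e ◁ β ▷ g = ζ`.
  have hγβ : vcomp (of γ.hom) (whisk (𝟙 _) (of S.β.hom) g)
      (by rw [whisk_src, Strict.id_comp, Strict.id_comp]) = one (S.m ≫ f) := by
    have hx := exchange (𝟙 _) S.β.hom (𝟙 _) γ.hom (𝟙 _)
    have h₁ := S.whisk_β_m_comp (𝟙 _) f
    have h₂ : whisk (S.m ≫ T.ι X.carrier ≫ S.e) (of γ.hom) (𝟙 _) = one (S.m ≫ f) := by
      have := congrArg (fun x => whisk S.m x (𝟙 _)) hι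
      rw [← Strict.assoc, hγ']
      simpa only [whisk_whisk, whisk_one, Strict.comp_id] using this
    simp only [Strict.id_comp, Strict.comp_id, whisk_id] at hx h₁
    simp only [h₁, h₂, one_vcomp] at hx
    exact hx.symm
  refine ⟨⟨g, hstrict⟩, hn, ?_⟩
  have h₁ := congrArg (fun x => whisk S.e x (𝟙 _)) hγβ
  simp only [whisk_vcomp, hγ, whisk_whisk, Strict.comp_id, whisk_one] at h₁
  exact (vcomp_reassoc_one (of_hom_inv ζ) _
    (by rw [whisk_src, Strict.id_comp, heg])).symm.trans
      ((vcomp_congr rfl h₁ _).trans (vcomp_one _ _))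

end

/-- Every pseudomorphism to a strict algebra factors uniquely as the unit followed by a strict
map. -/
theorem existsUnique_strict_map {E M : MorphismProperty K} (h : IsEnhancedFactorizationSystem E M)
    (hT : T.Preserves E) (he : E S.e) {Y : AlgSt T} (f : PsAlg.Hom X Y.toPsAlg) :
    ∃! g : AlgSt.Hom S.alg Y, PsAlg.comp S.unit g.toPsAlg = f := by
  refine existsUnique_of_exists_of_unique ?_ ?_
  · have hζ := (PsAlg.whisk_ζ_ζ_iff f.f f.ζ).1 f.ζ_ζ
    simp only [eqToIso.hom, of_eqToHom, whisk_one, one_vcomp] at hζ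
    obtain ⟨g, hg⟩ := S.exists_strict_map (Y := Y) (f := f.f) (ζ := f.ζ) h hT he
      (whisk_ι_inv ((PsAlg.whisk_ι_ζ_iff f.f f.ζ).1 f.ι_ζ)) (vcomp_inv hζ)
    exact ⟨g, (S.unit_comp_eq_iff g f).2 hg⟩
  · intro g g' hg hg'
    rw [unit_comp_eq_iff] at hg hg'
    have hM : M (𝟙 Y.carrier) := h.right_of_iso _ (𝟙 _) (Strict.id_comp _) (Strict.id_comp _)
    have hn (k : AlgSt.Hom S.alg Y) (hk : (T.ι X.carrier ≫ S.e) ≫ k.f = f.f) :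
        S.m ≫ f.f = (S.m ≫ T.ι X.carrier ≫ S.e) ≫ k.f := by
      rw [← hk]
      exact (Strict.assoc _ _ _).symm
    have he' (k : AlgSt.Hom S.alg Y) (hk : (T.ι X.carrier ≫ S.e) ≫ k.f = f.f) :
        S.e ≫ k.f = T.map f.f ≫ Y.act := by
      rw [← hk, T.map_comp, Strict.assoc, k.comm, comp_reassoc S.map_section_act]
    have hinv (k : AlgSt.Hom S.alg Y) (hk : whisk S.e (of S.β.hom) k.f = of f.ζ.hom) :
        whisk S.e (of S.β.inv) k.f = of f.ζ.inv :=
      of_inv_congr (whiskerLeftIso S.e (whiskerRightIso S.β k.f)) f.ζ hk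
    -- For any solution `k`, the pair of `k` and `β⁻¹ ▷ k` fills the square of `ζ⁻¹` used for
    -- existence, so `k` is determined.
    refine AlgSt.Hom.ext (h.filler_unique he hM (u := S.m ≫ f.f)
      (eqToIso (hn g hg.1) ≪≫ whiskerRightIso S.β.symm g.f ≪≫
        eqToIso (by rw [Strict.id_comp, Strict.comp_id]))
      (eqToIso (hn g' hg'.1) ≪≫ whiskerRightIso S.β.symm g'.f ≪≫
        eqToIso (by rw [Strict.id_comp, Strict.comp_id]))
      ((he' g hg.1).trans (he' g' hg'.1).symm) ?_).1
    simp only [Iso.trans_hom, Iso.symm_hom, eqToIso.hom, whiskerRightIso_hom, of_comp, of_eqToHom,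
      one_vcomp, vcomp_one, of_whiskerRight, whisk_whisk, Strict.comp_id]
    exact (hinv g hg.2).trans (hinv g' hg'.2).symm

end Strictification

/-! ### Whiskering with an equivalence -/

section

variable {B : Type u₁} [Bicategory.{w₁, v₁} B] {a b c : B}

/-- Whiskering by `k ≫ f` is conjugate to whiskering by `𝟙` through `i`, so `f ◁ α` determines `α`.
-/
theorem whiskerLeft_injective_of_iso {f : a ⟶ b} {k : b ⟶ a} (i : k ≫ f ≅ 𝟙 b) {g g' : b ⟶ c}
    {α α' : g ⟶ g'} (h : f ◁ α = f ◁ α') : α = α' := by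
  have h₁ : (k ≫ f) ◁ α = (k ≫ f) ◁ α' := by
    rw [comp_whiskerLeft, comp_whiskerLeft, h]
  have h₂ : 𝟙 b ◁ α = 𝟙 b ◁ α' := by
    have e := whisker_exchange i.hom α
    rw [h₁, whisker_exchange] at e
    exact ((cancel_epi (i.hom ▷ g)).1 e).symm
  simpa using h₂

theorem whiskerLeft_bijective (e : Bicategory.Equivalence a b) (g g' : b ⟶ c) :
    Function.Bijective (fun α : g ⟶ g' => e.hom ◁ α) := by
  refine ⟨fun _ _ h => whiskerLeft_injective_of_iso e.counit h, fun δ => ?_⟩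
  -- The preimage is `e.inv ◁ δ` conjugated by the counit. It is compared with `δ` only after
  -- whiskering with `e.inv`, which is injective by the unit; no triangle identity enters.
  let α : g ⟶ g' := (λ_ g).inv ≫ e.counit.inv ▷ g ≫ (α_ _ _ _).hom ≫ e.inv ◁ δ ≫
    (α_ _ _ _).inv ≫ e.counit.hom ▷ g' ≫ (λ_ g').hom
  refine ⟨α, whiskerLeft_injective_of_iso e.unit.symm (f := e.inv) ?_⟩
  have h : e.counit.hom ▷ g ≫ 𝟙 b ◁ α = (α_ _ _ _).hom ≫ e.inv ◁ δ ≫ (α_ _ _ _).inv ≫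
      e.counit.hom ▷ g' := by
    simp [α]
  rw [← whisker_exchange, ← Category.assoc, ← Category.assoc,
    cancel_mono (e.counit.hom ▷ g')] at h
  simpa using h

end

/-! ### From universal arrows to a left 2-adjoint -/

variable {B : Type u₁} [Bicategory.{w₁, v₁} B] {C : Type u₂} [Bicategory.{w₂, v₂} C]

/-- A family of arrows to a 2-functor with the two-dimensional universal property. -/
structure UniversalArrows (J : StrictPseudofunctor C B) where
  obj : B → C
  unit (b : B) : b ⟶ J.obj (obj b)
  existsUnique {b : B} {c : C} (f : b ⟶ J.obj c) : ∃! g : obj b ⟶ c, unit b ≫ J.map g = f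
  bijective {b : B} {c : C} (g g' : obj b ⟶ c) :
    Function.Bijective (fun α : g ⟶ g' => unit b ◁ J.map₂ α)

namespace UniversalArrows

variable {J : StrictPseudofunctor C B} (U : UniversalArrows J)

/-- The 1-cell induced by the universal property. -/
noncomputable def lift {b : B} {c : C} (f : b ⟶ J.obj c) : U.obj b ⟶ c := (U.existsUnique f).choose

theorem unit_lift {b : B} {c : C} (f : b ⟶ J.obj c) : U.unit b ≫ J.map (U.lift f) = f :=
  (U.existsUnique f).choose_spec.1

theorem hom_ext {b : B} {c : C} {g g' : U.obj b ⟶ c}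
    (h : U.unit b ≫ J.map g = U.unit b ≫ J.map g') : g = g' :=
  (U.existsUnique _).unique h rfl

theorem exists_lift₂ {b : B} {c : C} {f f' : b ⟶ J.obj c} (α : f ⟶ f') :
    ∃ γ : U.lift f ⟶ U.lift f', of (U.unit b ◁ J.map₂ γ) = of α := by
  obtain ⟨γ, hγ⟩ := (U.bijective (U.lift f) (U.lift f')).2
    (eqToHom (U.unit_lift f) ≫ α ≫ eqToHom (U.unit_lift f').symm)
  exact ⟨γ, (congrArg of hγ).trans (of_eqToHom_comp_eqToHom _ _ _)⟩

/-- The 2-cell induced by the universal property. -/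
noncomputable def lift₂ {b : B} {c : C} {f f' : b ⟶ J.obj c} (α : f ⟶ f') : U.lift f ⟶ U.lift f' :=
  (U.exists_lift₂ α).choose

variable [Bicategory.Strict B]

theorem whisk_unit_lift₂ {b : B} {c : C} {f f' : b ⟶ J.obj c} (α : f ⟶ f') :
    whisk (U.unit b) ((of (U.lift₂ α)).map J) (𝟙 _) = of α :=
  (of_whiskerLeft _ _).symm.trans (U.exists_lift₂ α).choose_spec

/-- Both dimensions of uniqueness at once: the ends agree by `hom_ext`, then the 2-cells by
injectivity. The 2-cell laws of the left adjoint and the 2-naturality of the counit are checked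
through it. -/
theorem cell_ext {b : B} {c : C} {x y : Cell (U.obj b) c}
    (h : whisk (U.unit b) (x.map J) (𝟙 _) = whisk (U.unit b) (y.map J) (𝟙 _)) : x = y := by
  obtain ⟨s, t, α⟩ := x
  obtain ⟨s', t', α'⟩ := y
  rw [← of_map₂, ← of_whiskerLeft, ← of_map₂, ← of_whiskerLeft] at h
  obtain rfl : s = s' := U.hom_ext (congrArg src h)
  obtain rfl : t = t' := U.hom_ext (congrArg tgt h)
  obtain rfl : α = α' := (U.bijective s t).1 (of_injective h)
  rfl

theorem whisk_comp_unit_lift₂ {b d d' : B} {c : C} {f f' : b ⟶ J.obj c} (α : f ⟶ f') (p : d ⟶ b)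
    (q : J.obj c ⟶ d') :
    whisk (p ≫ U.unit b) ((of (U.lift₂ α)).map J) q = whisk p (of α) q := by
  rw [← U.whisk_unit_lift₂ α, whisk_whisk, Strict.id_comp]

theorem unit_naturality₂ {b b' : B} {f g : b ⟶ b'} (α : f ⟶ g) :
    α ▷ U.unit b' ≫ eqToHom (U.unit_lift (g ≫ U.unit b')).symm =
      eqToHom (U.unit_lift (f ≫ U.unit b')).symm ≫
        U.unit b ◁ J.map₂ (U.lift₂ (α ▷ U.unit b')) := by
  refine of_injective ?_
  simp only [of_comp, of_eqToHom, one_vcomp, vcomp_one]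
  rw [of_whiskerLeft, of_map₂, U.whisk_unit_lift₂]

theorem counit_naturality {c c' : C} (f : c ⟶ c') :
    U.lift (J.map f ≫ U.unit (J.obj c')) ≫ U.lift (𝟙 (J.obj c')) = U.lift (𝟙 (J.obj c)) ≫ f :=
  U.hom_ext (by
    rw [J.map_comp, J.map_comp, comp_reassoc (U.unit_lift _), comp_reassoc (U.unit_lift _),
      Strict.assoc, U.unit_lift, Strict.id_comp, Strict.comp_id])

variable [Bicategory.Strict C]

/-- The left 2-adjoint given by a family of universal arrows. -/
noncomputable def leftAdjoint : StrictPseudofunctor B C :=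
  StrictPseudofunctor.mk''
    { obj := U.obj
      -- The values on 1-cells and 2-cells are forced by 2-naturality of the unit.
      map := fun {_ b'} f => U.lift (f ≫ U.unit b')
      map₂ := fun {_ b'} _ _ α => U.lift₂ (α ▷ U.unit b')
      map₂_id := fun f => of_injective (U.cell_ext (by
        rw [U.whisk_unit_lift₂, id_whiskerRight, Cell.map_one, whisk_one, Strict.comp_id,
          U.unit_lift]))
      map₂_comp := fun α β => of_injective (U.cell_ext (by
        rw [U.whisk_unit_lift₂, comp_whiskerRight, of_comp, of_comp, map_vcomp]
        exact ((whisk_vcomp _ _ _ _ _).trans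
          (vcomp_congr (U.whisk_unit_lift₂ _) (U.whisk_unit_lift₂ _) _)).symm))
      map_id := fun b => U.hom_ext (by
        rw [U.unit_lift, J.map_id, Strict.id_comp, Strict.comp_id])
      map_comp := fun f g => U.hom_ext (by
        rw [U.unit_lift, J.map_comp, comp_reassoc (U.unit_lift _), Strict.assoc, Strict.assoc,
          U.unit_lift])
      map₂_whisker_left := fun f _ _ α => of_injective (U.cell_ext (by
        rw [U.whisk_unit_lift₂, of_eqToHom_comp_eqToHom, of_whiskerRight, of_whiskerLeft,
          of_whiskerLeft, map_whisk, whisk_whisk, whisk_whisk, U.unit_lift, J.map_id,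
          U.whisk_comp_unit_lift₂, of_whiskerRight, whisk_whisk]
        simp only [Strict.id_comp, Strict.comp_id]))
      map₂_whisker_right := fun α h => of_injective (U.cell_ext (by
        rw [U.whisk_unit_lift₂, of_eqToHom_comp_eqToHom, of_whiskerRight, of_whiskerRight,
          of_whiskerRight, map_whisk, whisk_whisk, whisk_whisk, J.map_id, Strict.comp_id,
          Strict.comp_id, Strict.comp_id]
        have := U.whisk_comp_unit_lift₂ (α ▷ U.unit _) (𝟙 _) (J.map (U.lift (h ≫ U.unit _)))
        rw [Strict.id_comp] at this
        rw [this, of_whiskerRight, whisk_whisk, U.unit_lift, Strict.id_comp])) }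

theorem counit_naturality₂ {c c' : C} {f g : c ⟶ c'} (α : f ⟶ g) :
    U.lift₂ (J.map₂ α ▷ U.unit (J.obj c')) ▷ U.lift (𝟙 (J.obj c')) ≫
        eqToHom (U.counit_naturality g) =
      eqToHom (U.counit_naturality f) ≫ U.lift (𝟙 (J.obj c)) ◁ α := by
  refine of_injective ?_
  simp only [of_comp, of_eqToHom, one_vcomp, vcomp_one]
  refine U.cell_ext ?_
  have h := U.whisk_comp_unit_lift₂ (J.map₂ α ▷ U.unit (J.obj c')) (𝟙 _) (J.map (U.lift (𝟙 _)))
  rw [Strict.id_comp] at h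
  rw [of_whiskerLeft, of_whiskerRight, map_whisk, map_whisk, whisk_whisk, whisk_whisk,
    U.unit_lift, J.map_id, J.map_id, Strict.comp_id, Strict.comp_id, Strict.comp_id, h,
    of_whiskerRight, whisk_whisk, U.unit_lift, Strict.id_comp, of_map₂]

/-- The 2-adjunction of a family of universal arrows. -/
noncomputable def adjunction : TwoAdjunction U.leftAdjoint J where
  unit :=
    { app := U.unit
      naturality := fun {_ b'} f => (U.unit_lift (f ≫ U.unit b')).symm
      naturality₂ := U.unit_naturality₂ }
  counit :=
    { app := fun c => U.lift (𝟙 (J.obj c))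
      naturality := U.counit_naturality
      naturality₂ := U.counit_naturality₂ }
  left_triangle b := U.hom_ext (by
    change U.unit b ≫ J.map (U.lift (U.unit b ≫ U.unit _) ≫ U.lift (𝟙 _)) =
      U.unit b ≫ J.map (𝟙 _)
    rw [J.map_comp, comp_reassoc (U.unit_lift _), Strict.assoc, U.unit_lift, J.map_id])
  right_triangle c := U.unit_lift _

end UniversalArrows

end PowerLack

/-! ### The theorem -/

theorem theorem0p1 {K : Type u} [Bicategory.{w, v} K] [Bicategory.Strict K]
    (E M : MorphismProperty K) (hEM : PowerLack.IsRigidEnhancedFactorizationSystem E M)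
    (T : PowerLack.TwoMonad K) (hT : T.Preserves E) :
    ∃ (St : StrictPseudofunctor (PowerLack.PsAlg T) (PowerLack.AlgSt T))
      (adj : PowerLack.TwoAdjunction St (PowerLack.inclusion T)),
      ∀ X : PowerLack.PsAlg T,
        ∃ e : Bicategory.Equivalence X ((PowerLack.inclusion T).obj (St.obj X)),
          e.hom = adj.unit.app X := by
  choose S hS using PowerLack.exists_strictification hEM hT
  let U : PowerLack.UniversalArrows (PowerLack.inclusion T) :=
    { obj := fun X => (S X).alg
      unit := fun X => (S X).unit
      existsUnique := fun {X Y} f =>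
        (S X).existsUnique_strict_map hEM.toIsEnhancedFactorizationSystem hT (hS X) f
      bijective := fun {X Y} g g' => by
        have h := PowerLack.whiskerLeft_bijective (S X).equivalence ((PowerLack.inclusion T).map g)
          ((PowerLack.inclusion T).map g')
        -- The inclusion is bijective on 2-cells: between strict maps, the two notions of algebra
        -- 2-cell have the same data and the same condition.
        refine h.comp ⟨fun α β e => PowerLack.AlgSt.hom₂_ext (congrArg PowerLack.PsAlg.Hom₂.cell e),
          fun α => ?_⟩
        exact ⟨⟨PowerLack.PsAlg.Hom₂.cell α, PowerLack.PsAlg.Hom₂.comm α⟩, rfl⟩ }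
  exact ⟨U.leftAdjoint, U.adjunction, fun X => ⟨(S X).equivalence, rfl⟩⟩
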